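/- Let $X$, $Y$, $W$ be fs log stacks (stacks in groupoids for the étale topology on schemes, equipped with a fine and saturated log structure; algebraicity is not needed), and let $f\colon X\to Y$ and $g\colon W\to Y$ be log morphisms. For a geometric point $\bar x$ of an fs log stack $X$, let $\overline{\mathcal M}_{X,\bar x}$ be the stalk of the ghost sheaf $\mathcal M_X/\mathcal O_X^\times$ and let $\sigma_{\bar x}=\operatorname{Hom}(\overline{\mathcal M}_{X,\bar x},\mathbb R_{\ge 0})$ be the associated cone of the tropicalization $\Sigma(X)$. If $f(\bar x)=\bar y$, let $\Sigma(f)\colon\sigma_{\bar x}\to\sigma_{\bar y}$ be the map of cones induced by the homomorphism $\overline{\mathcal M}_{Y,\bar y}\to\overline{\mathcal M}_{X,\bar x}$; similarly for $g$. Suppose that $W$ is free, i.e. every stalk $\overline{\mathcal M}_{W,\bar w}$ is isomorphic to $\mathbb N^r$ for some $r\ge 0$. Suppose further that for all geometric points $\bar x$ of $X$, $\bar y$ of $Y$ and $\bar w$ of $W$ with identifications $f(\bar x)=\bar y=g(\bar w)$, and for every face $F$ of $\sigma_{\bar x}$, the set $\Sigma(g)^{-1}(\Sigma(f)(F))\subseteq\sigma_{\bar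 w}$ is a face of $\sigma_{\bar w}$. Then $g$ is transverse to $f$: the first projection $W\times_Y^{\mathrm{fs}}X\to W$ from the fibre product in fs log stacks is an integral morphism, i.e. for every geometric point $\bar z$ of $W\times_Y^{\mathrm{fs}}X$ with image $\bar w$ in $W$, the homomorphism $\overline{\mathcal M}_{W,\bar w}\to\overline{\mathcal M}_{W\times_Y^{\mathrm{fs}}X,\bar z}$ is an integral homomorphism of monoids. -/

import Mathlib

open CategoryTheory CategoryTheory.Limits AlgebraicGeometry Opposite

universe u

noncomputable section

/-! ### Commutative monoids -/

/-- A fine and saturated (fs) commutative monoid, written multiplicatively: finitely generated,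
cancellative (integral), and saturated, i.e. an element of the group completion a positive power
of which lies in the monoid lies itself in the monoid. The element of the group completion is
written `b / a`; that `(b / a) ^ n` (resp. `b / a`) lies in the monoid means `a ^ n ∣ b ^ n`
(resp. `a ∣ b`). -/
structure IsFsMonoid (P : Type u) [CommMonoid P] : Prop where
  fg : Monoid.FG P
  integral : IsCancelMul P
  saturated : ∀ (a b : P) (n : ℕ), 0 < n → a ^ n ∣ b ^ n → a ∣ b

/-- A homomorphism `θ : P → Q` of commutative monoids is integral if for every homomorphism
`P → P'` with `P'` integral (cancellative), the pushout `Q ⊕_P P'`, formed in the category of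
commutative monoids, is integral. -/
def IsIntegralMonoidHom {P Q : Type u} [CommMonoid P] [CommMonoid Q] (θ : P →* Q) : Prop :=
  ∀ (P' Q' : CommMonCat.{u}) (θ' : CommMonCat.of P ⟶ P') (i : CommMonCat.of Q ⟶ Q')
    (j : P' ⟶ Q'), IsCancelMul P' → IsPushout (CommMonCat.ofHom θ) θ' i j → IsCancelMul Q'

/-- The homomorphism induced by `θ : P → Q` on the quotients by the units. -/
def sharpMap {P Q : Type u} [CommMonoid P] [CommMonoid Q] (θ : P →* Q) :
    Associates P →* Associates Q where
  toFun := Quotient.map θ fun _ _ h => h.map θ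
  map_one' := congrArg Associates.mk θ.map_one
  map_mul' a b := by
    induction a using Quotient.inductionOn
    induction b using Quotient.inductionOn
    exact congrArg Associates.mk (θ.map_mul _ _)

/-- A commutative monoid is free if it is isomorphic to `ℕ ^ r` for some `r`. -/
def IsFreeCommMonoid (P : Type u) [CommMonoid P] : Prop :=
  ∃ r : ℕ, Nonempty (P ≃* Multiplicative (Fin r → ℕ))

/-- The cone `Hom(P, ℝ≥0)` dual to a commutative monoid `P`, as a cone in the real vector space
`Hom(P, ℝ) = Hom(P^gp, ℝ)`. -/
def dualCone (P : Type u) [CommMonoid P] : PointedCone ℝ (Additive P →+ ℝ) where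
  carrier := {v | ∀ a, 0 ≤ v a}
  add_mem' := fun hv hw a => add_nonneg (hv a) (hw a)
  zero_mem' := fun _ => le_rfl
  smul_mem' := fun c _ hv a => mul_nonneg c.2 (hv a)

/-- The linear map `Hom(Q, ℝ) → Hom(P, ℝ)` given by composition with `θ : P → Q`. It maps
`dualCone Q` into `dualCone P`. -/
def dualMap {P Q : Type u} [CommMonoid P] [CommMonoid Q] (θ : P →* Q) :
    (Additive Q →+ ℝ) →ₗ[ℝ] (Additive P →+ ℝ) where
  toFun v := v.comp (MonoidHom.toAdditive θ)
  map_add' _ _ := rfl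
  map_smul' _ _ := rfl

/-! ### Stacks in groupoids for the étale topology -/

/-- The based category over the category of schemes represented by the scheme `S`. -/
def schemeCat (S : Scheme.{u}) : BasedCategory.{u, u + 1} Scheme.{u} :=
  BasedCategory.ofFunctor (Over.forget S)

/-- A sieve `R` on the scheme `S`, as a full subcategory of the category of schemes over `S`. -/
def sieveCat {S : Scheme.{u}} (R : Sieve S) : BasedCategory.{u, u + 1} Scheme.{u} :=
  BasedCategory.ofFunctor
    (ObjectProperty.ι (fun U : Over S => R U.hom) ⋙ Over.forget S)

/-- The inclusion of a sieve on `S` into all schemes over `S`. -/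
def sieveIncl {S : Scheme.{u}} (R : Sieve S) : BasedFunctor (sieveCat R) (schemeCat S) where
  toFunctor := ObjectProperty.ι (fun U : Over S => R U.hom)
  w := rfl

/-- Restriction of base preserving functors from `S` to a sieve on `S`. The source is the category
of objects of `𝒳` over `S` (by the 2-Yoneda lemma), the target is the category of descent data
for objects of `𝒳` relative to the sieve. -/
def restrictToSieve (𝒳 : BasedCategory.{u, u + 1} Scheme.{u}) {S : Scheme.{u}} (R : Sieve S) :
    BasedFunctor (schemeCat S) 𝒳 ⥤ BasedFunctor (sieveCat R) 𝒳 where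
  obj F := (sieveIncl R).comp F
  map η := BasedCategory.whiskerLeft (sieveIncl R) η

/-- Categories fibred in groupoids over schemes: a fibred category all of whose morphisms are
strongly cartesian. -/
structure IsFiberedInGroupoids (𝒳 : BasedCategory.{u, u + 1} Scheme.{u}) : Prop where
  isFibered : 𝒳.p.IsFibered
  isStronglyCartesian : ∀ {x y : 𝒳.obj} (φ : x ⟶ y), 𝒳.p.IsStronglyCartesian (𝒳.p.map φ) φ

/-- Effective descent for objects and morphisms, with respect to the étale topology. -/
def HasEtaleDescent (𝒳 : BasedCategory.{u, u + 1} Scheme.{u}) : Prop :=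
  ∀ (S : Scheme.{u}) (R : Sieve S), R ∈ Scheme.etaleTopology S →
    (restrictToSieve 𝒳 R).IsEquivalence

/-! ### Fs log structures -/

/-- A property of objects `y → x` over `x` which holds étale locally on `x`: it holds for all
`y → x` the image of which in the category of schemes belongs to some covering sieve for the
étale topology. -/
def EtaleLocally (𝒳 : BasedCategory.{u, u + 1} Scheme.{u}) (x : 𝒳.obj)
    (A : ∀ y : 𝒳.obj, (y ⟶ x) → Prop) : Prop :=
  ∃ R ∈ Scheme.etaleTopology (𝒳.p.obj x), ∀ (y : 𝒳.obj) (φ : y ⟶ x), R (𝒳.p.map φ) → A y φ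

/-- A homomorphism `c : P → M(x)` is a chart for the presheaf of monoids `M` on the objects over
`x`: the homomorphism from the log structure associated to `P` (the sheafification of the
presheaf pushout of `P ← {a | c a invertible} → Mˣ`) to `M` is an isomorphism, that is to say
locally surjective and locally injective. -/
structure IsChart {𝒳 : BasedCategory.{u, u + 1} Scheme.{u}} (M : 𝒳.objᵒᵖ ⥤ CommMonCat.{u})
    {x : 𝒳.obj} {P : Type u} [CommMonoid P] (c : P →* M.obj (op x)) : Prop where
  surj : ∀ {y : 𝒳.obj} (φ : y ⟶ x) (m : M.obj (op y)),
    EtaleLocally 𝒳 y fun z ψ =>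
      ∃ (a : P) (v : (M.obj (op z))ˣ), M.map ψ.op m = M.map (ψ ≫ φ).op (c a) * v
  inj : ∀ {y : 𝒳.obj} (φ : y ⟶ x) (a b : P) (v w : (M.obj (op y))ˣ),
    M.map φ.op (c a) * v = M.map φ.op (c b) * w →
    EtaleLocally 𝒳 y fun _ ψ =>
      ∃ r s : P, IsUnit (M.map (ψ ≫ φ).op (c r)) ∧ IsUnit (M.map (ψ ≫ φ).op (c s)) ∧
        a * r = b * s ∧
        M.map ψ.op v * M.map (ψ ≫ φ).op (c s) = M.map ψ.op w * M.map (ψ ≫ φ).op (c r)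

/-- A category fibred in groupoids over schemes with an fs log structure. The log structure is
given on the big étale site: a sheaf of monoids `M` with a homomorphism `α` to the structure
sheaf which is an isomorphism over the invertible functions, such that étale locally on every
object there is a chart by an fs monoid; the chart is required to remain a chart after every base
change, so that `M` is the pull-back log structure along every morphism. -/
structure FsLogCFG where
  /-- The underlying category over schemes. -/
  toCat : BasedCategory.{u, u + 1} Scheme.{u}
  isFiberedInGroupoids : IsFiberedInGroupoids toCat
  /-- The sheaf of monoids. -/
  M : toCat.objᵒᵖ ⥤ CommMonCat.{u}
  /-- The structure homomorphism. -/
  α : ∀ x : toCat.obj, M.obj (op x) →* Γ(toCat.p.obj x, ⊤)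
  α_map : ∀ {x y : toCat.obj} (φ : x ⟶ y) (m : M.obj (op y)),
    α x (M.map φ.op m) = (toCat.p.map φ).appTop (α y m)
  isSheaf : ∀ (x : toCat.obj) (R : Sieve (toCat.p.obj x)),
    R ∈ Scheme.etaleTopology (toCat.p.obj x) →
      Presieve.IsSheafFor (M ⋙ forget CommMonCat) (R.functorPullback toCat.p).arrows
  isLog : ∀ (x : toCat.obj) (v : Γ(toCat.p.obj x, ⊤)ˣ), ∃! m : M.obj (op x), α x m = v
  isFs : ∀ x : toCat.obj, EtaleLocally toCat x fun y _ =>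
    ∃ (P : Type u) (_ : CommMonoid P) (c : P →* M.obj (op y)), IsFsMonoid P ∧ IsChart M c

/-- An fs log stack: a stack in groupoids for the étale topology on schemes, with an fs log
structure. -/
structure FsLogStack extends FsLogCFG.{u} where
  hasEtaleDescent : HasEtaleDescent toCat

namespace FsLogCFG

/-- An fs log scheme: the underlying category fibred in groupoids is representable by a scheme,
i.e. has a terminal object `x` (and is then equivalent to the category of schemes over `p x`). -/
def IsLogScheme (T : FsLogCFG.{u}) : Prop := HasTerminal T.toCat.obj

/-- A log morphism `X → Y`: a morphism `F` of the underlying categories over schemes and a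
homomorphism `M_Y(F x) → M_X(x)`, natural in `x`, that is compatible with the structure
homomorphisms to functions on the scheme `p (F x) = p x`. -/
structure Hom (X Y : FsLogCFG.{u}) extends BasedFunctor X.toCat Y.toCat where
  flat : toFunctor.op ⋙ Y.M ⟶ X.M
  α_flat : ∀ (x : X.toCat.obj) (m : Y.M.obj (op (obj x))), X.α x (flat.app (op x) m) =
    (eqToHom (toBasedFunctor.w_obj x).symm :
      X.toCat.p.obj x ⟶ Y.toCat.p.obj (obj x)).appTop (Y.α (obj x) m)

/-- Composition of log morphisms. -/
def Hom.comp {X Y Z : FsLogCFG.{u}} (f : Hom X Y) (g : Hom Y Z) : Hom X Z where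
  toBasedFunctor := f.toBasedFunctor.comp g.toBasedFunctor
  flat := Functor.whiskerLeft f.toFunctor.op g.flat ≫ f.flat
  α_flat x m := by
    have h₁ := f.α_flat x (g.flat.app (op (f.obj x)) m)
    have h₂ := g.α_flat (f.obj x) m
    refine h₁.trans ((congrArg _ h₂).trans ?_)
    rw [← CommRingCat.comp_apply, ← Scheme.Hom.comp_appTop, eqToHom_trans]
    rfl

/-- A 2-isomorphism between log morphisms `f, g : X → Y`: an isomorphism of functors over schemes
that is compatible with the homomorphisms of log structures. -/
structure Iso₂ {X Y : FsLogCFG.{u}} (f g : Hom X Y) where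
  iso : f.toBasedFunctor ≅ g.toBasedFunctor
  flat_comp : ∀ x : X.toCat.obj,
    Y.M.map (iso.hom.app x).op ≫ f.flat.app (op x) = g.flat.app (op x)

/-- The component at `x` of a 2-isomorphism. -/
def Iso₂.app {X Y : FsLogCFG.{u}} {f g : Hom X Y} (η : Iso₂ f g) (x : X.toCat.obj) :
    f.obj x ⟶ g.obj x :=
  η.iso.hom.app x

/-- The 2-commutative square formed by `p : Z → W`, `q : Z → X`, `g : W → Y`, `f : X → Y` and
`γ : g ∘ p ≅ f ∘ q` exhibits `Z` as the fs fibre product of `W` and `X` over `Y`: for every fs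
log scheme `T`, the groupoid of log morphisms `T → Z` is equivalent to the groupoid of triples
consisting of log morphisms `a : T → W`, `b : T → X` and a 2-isomorphism `g ∘ a ≅ f ∘ b`. -/
structure IsFsFibreProduct {W X Y Z : FsLogCFG.{u}} {g : Hom W Y} {f : Hom X Y} {p : Hom Z W}
    {q : Hom Z X} (γ : Iso₂ (p.comp g) (q.comp f)) : Prop where
  lift : ∀ (T : FsLogCFG.{u}), T.IsLogScheme → ∀ (a : Hom T W) (b : Hom T X)
    (δ : Iso₂ (a.comp g) (b.comp f)),
    ∃ (h : Hom T Z) (μ : Iso₂ (h.comp p) a) (ν : Iso₂ (h.comp q) b), ∀ t : T.toCat.obj,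
      g.map (μ.app t) ≫ δ.app t = γ.app (h.obj t) ≫ f.map (ν.app t)
  unique : ∀ (T : FsLogCFG.{u}), T.IsLogScheme → ∀ (h h' : Hom T Z)
    (μ : Iso₂ (h.comp p) (h'.comp p)) (ν : Iso₂ (h.comp q) (h'.comp q)),
    (∀ t : T.toCat.obj,
      g.map (μ.app t) ≫ γ.app (h'.obj t) = γ.app (h.obj t) ≫ f.map (ν.app t)) →
    ∃! η : Iso₂ h h', ∀ t : T.toCat.obj, p.map (η.app t) = μ.app t ∧ q.map (η.app t) = ν.app t

/-! ### Geometric points, ghost sheaf and tropicalization -/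

/-- An object is a geometric point if it lies over the spectrum of an algebraically closed
field. -/
def IsGeometricPoint (X : FsLogCFG.{u}) (x : X.toCat.obj) : Prop :=
  ∃ (K : Type u) (_ : Field K), IsAlgClosed K ∧
    Nonempty (X.toCat.p.obj x ≅ Spec (CommRingCat.of K))

/-- The stalk of the ghost sheaf at a geometric point `x`: the quotient of the stalk of the log
structure (pulled back to `x`) by its units. As `x` lies over the spectrum of an algebraically
closed field, the stalk at `x` of the étale sheaf `M` is `M(x)`. -/
abbrev Ghost (X : FsLogCFG.{u}) (x : X.toCat.obj) : Type u := Associates (X.M.obj (op x))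

/-- The homomorphism of ghost stalks induced by a log morphism `f`, from the stalk of `Y` at a
point `y` that is identified with `f(x)` to the stalk of `X` at `x`. -/
def Hom.ghost {X Y : FsLogCFG.{u}} (f : Hom X Y) (x : X.toCat.obj) {y : Y.toCat.obj}
    (e : f.obj x ≅ y) : Y.Ghost y →* X.Ghost x :=
  sharpMap ((Y.M.map e.hom.op) ≫ f.flat.app (op x)).hom

/-- The cone `σ_x = Hom(ghost stalk at x, ℝ≥0)` of the tropicalization at a geometric point. -/
abbrev cone (X : FsLogCFG.{u}) (x : X.toCat.obj) :
    PointedCone ℝ (Additive (X.Ghost x) →+ ℝ) :=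
  dualCone (X.Ghost x)

/-- The linear map `Σ(f) : σ_x → σ_y` for a geometric point `y` identified with `f(x)`. -/
abbrev Hom.trop {X Y : FsLogCFG.{u}} (f : Hom X Y) (x : X.toCat.obj) {y : Y.toCat.obj}
    (e : f.obj x ≅ y) : (Additive (X.Ghost x) →+ ℝ) →ₗ[ℝ] (Additive (Y.Ghost y) →+ ℝ) :=
  dualMap (f.ghost x e)

/-- All stalks of the ghost sheaf are free monoids. -/
def IsFree (W : FsLogCFG.{u}) : Prop :=
  ∀ w : W.toCat.obj, W.IsGeometricPoint w → IsFreeCommMonoid (W.Ghost w)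

/-- A log morphism is integral if at every geometric point it induces an integral homomorphism of
stalks of ghost sheaves. -/
def Hom.IsIntegral {Z W : FsLogCFG.{u}} (p : Hom Z W) : Prop :=
  ∀ z : Z.toCat.obj, Z.IsGeometricPoint z → IsIntegralMonoidHom (p.ghost z (Iso.refl _))

end FsLogCFG

open FsLogCFG in
/-- A morphism `g : W → Y` of fs log stacks is transverse to `f : X → Y` if the projection of the
fs fibre product of `W` and `X` over `Y` to `W` is an integral morphism. -/
def IsTransverse {W X Y : FsLogStack.{u}} (g : Hom W.toFsLogCFG Y.toFsLogCFG)
    (f : Hom X.toFsLogCFG Y.toFsLogCFG) : Prop :=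
  ∀ (Z : FsLogStack.{u}) (p : Hom Z.toFsLogCFG W.toFsLogCFG) (q : Hom Z.toFsLogCFG X.toFsLogCFG)
    (γ : Iso₂ (p.comp g) (q.comp f)), IsFsFibreProduct γ → p.IsIntegral

end

/-! Fix a geometric point `z` of the fs fibre product and let `R`, `N`, `Q`, `P` be the ghost stalks
of the product, `W`, `X`, `Y` at `z` and its images. The proof joins one fact about `R`
(`IsFsFibreProduct.exists_addMonoidHom`) to one argument on cones
(`isIntegralMonoidHom_of_isFaceOf`).

The fact: real-valued homomorphisms `v` on `Q` and `w` on `N` that agree on `P` extend to `R`, and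
every element of `R` has a positive power in the image of `Q × N`. Hence the dual cone of `R` is the
fibre product of those of `Q` and `N`. This is read off the universal property, without constructing
the product. The saturated graph `L ⊆ R × ℝ` of `(v, w)` defines an fs log structure on the scheme
under `z`, whose sections are pairs of a section for the fibre product and a locally constant real
function. Twisting the maps to `W` and `X` by `w` and `v` gives a compatible pair, hence a morphism
`h` to the fibre product. Uniqueness, tested after forgetting the functions, shows that `h`
restricts to the tautological map. So `h` provides a homomorphism `u : R → ℝ` with graph in `L`, and
membership in `L` gives everything required.

The cone argument: as `N` is free, it suffices that `p m * r = p n * s` with `m`, `n` coprime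
implies `p n ∣ r`. By Farkas' lemma and saturation this amounts to `v (p n) ≤ v r` for all `v` in
the dual cone of `R`. Split `v ∘ p = w₁ + w₂` with `w₁ m = 0` and `w₂ n = 0`. The face hypothesis,
applied to the smallest face containing `v ∘ q`, lifts `w₁` to some `v'` in the dual cone of `R`
that vanishes wherever `v` does. Since `v' (p m) = 0`, the equation gives `v' (p n) ≤ v' r`.
Subtracting from `v` the largest admissible multiple of `v'` leaves a form with more zeros among the
generators, and induction concludes. -/

noncomputable section

/-! ### Integral homomorphisms -/

section Integral

variable {N R : Type u} [CommMonoid N] [CommMonoid R]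

/-- Every element of a pushout of commutative monoids is a product of elements of the two
monoids. -/
theorem exists_eq_mul_of_isPushout {A B C D : CommMonCat.{u}} {f : A ⟶ B} {g : A ⟶ C} {i : B ⟶ D}
    {j : C ⟶ D} (h : IsPushout f g i j) (d : D) : ∃ b c, d = i b * j c := by
  let S : Submonoid D := MonoidHom.mrange (MonoidHom.coprod i.hom j.hom)
  let i' : B ⟶ CommMonCat.of S := CommMonCat.ofHom
    (i.hom.codRestrict S fun b => ⟨(b, 1), by simp⟩)
  let j' : C ⟶ CommMonCat.of S := CommMonCat.ofHom
    (j.hom.codRestrict S fun c => ⟨(1, c), by simp⟩)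
  have hw : f ≫ i' = g ≫ j' := by
    ext a
    exact congrArg (fun k : A ⟶ D => k a) h.w
  have hs : h.desc i' j' hw ≫ CommMonCat.ofHom S.subtype = 𝟙 D := by
    apply h.hom_ext
    · rw [h.inl_desc_assoc]; rfl
    · rw [h.inr_desc_assoc]; rfl
  obtain ⟨⟨b, c⟩, hbc⟩ := (h.desc i' j' hw d).2
  refine ⟨b, c, ?_⟩
  have : (h.desc i' j' hw ≫ CommMonCat.ofHom S.subtype) d = d := by rw [hs]; rfl
  rw [← this]
  exact hbc.symm

/-- The kernel congruence of the map from `R × P` to the pushout of the group completions of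
`R ← N → P`. -/
def pushoutCon {P : Type u} [CommMonoid P] [IsCancelMul R] [IsCancelMul P] (θ : N →* R)
    (θ' : N →* P) : Con (R × P) where
  r x y := ∃ m n, θ m * x.1 = θ n * y.1 ∧ θ' n * x.2 = θ' m * y.2
  iseqv :=
    { refl := fun x => ⟨1, 1, rfl, rfl⟩
      symm := fun ⟨m, n, h, h'⟩ => ⟨n, m, h.symm, h'.symm⟩
      trans := by
        rintro x y z ⟨m, n, h, h'⟩ ⟨m', n', k, k'⟩
        refine ⟨m * m', n * n', ?_, ?_⟩
        · rw [map_mul, map_mul, mul_assoc, mul_left_comm, h, mul_left_comm, k, mul_assoc]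
        · rw [map_mul, map_mul, mul_assoc, mul_left_comm, h', mul_left_comm, k', mul_assoc] }
  mul' := by
    rintro w x y z ⟨m, n, h, h'⟩ ⟨m', n', k, k'⟩
    refine ⟨m * m', n * n', ?_, ?_⟩
    · rw [Prod.fst_mul, Prod.fst_mul, map_mul, map_mul, mul_mul_mul_comm, h, k,
        mul_mul_mul_comm]
    · rw [Prod.snd_mul, Prod.snd_mul, map_mul, map_mul, mul_mul_mul_comm, h', k',
        mul_mul_mul_comm]

/-- The equational criterion for integrality of a homomorphism to a cancellative monoid. -/
theorem isIntegralMonoidHom_of_equational [IsCancelMul R] (θ : N →* R)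
    (hθ : ∀ m n r s, θ m * r = θ n * s →
      ∃ m' n' t, r = θ m' * t ∧ s = θ n' * t ∧ m * m' = n * n') :
    IsIntegralMonoidHom θ := by
  intro P Q θ' i j hP hQ
  let E := pushoutCon θ θ'.hom
  let i' : CommMonCat.of R ⟶ CommMonCat.of E.Quotient :=
    CommMonCat.ofHom (E.mk'.comp (MonoidHom.inl R P))
  let j' : P ⟶ CommMonCat.of E.Quotient :=
    CommMonCat.ofHom (E.mk'.comp (MonoidHom.inr R P))
  have hw : CommMonCat.ofHom θ ≫ i' = θ' ≫ j' := by
    ext a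
    refine (Con.eq E).2 ⟨1, a, ?_, ?_⟩
    · exact (congrArg (· * θ a) (map_one θ)).trans ((one_mul _).trans (mul_one _).symm)
    · exact (mul_one _).trans ((congrArg (· * θ'.hom a) (map_one θ'.hom)).trans (one_mul _)).symm
  have hi : ∀ r, hQ.desc i' j' hw (i r) = i' r := fun r =>
    congrArg (fun k : CommMonCat.of R ⟶ CommMonCat.of E.Quotient => k r) (hQ.inl_desc i' j' hw)
  have hj : ∀ p, hQ.desc i' j' hw (j p) = j' p := fun p =>
    congrArg (fun k : P ⟶ CommMonCat.of E.Quotient => k p) (hQ.inr_desc i' j' hw)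
  have hij : ∀ r p, hQ.desc i' j' hw (i r * j p) = E.mk' (r, p) := by
    intro r p
    rw [map_mul, hi, hj]
    change E.mk' (r, 1) * E.mk' (1, p) = _
    rw [← map_mul]
    simp
  have hn : ∀ n, i (θ n) = j (θ' n) := fun n =>
    congrArg (fun k : CommMonCat.of N ⟶ Q => k n) hQ.w
  have key : ∀ x y e : Q, e * x = e * y → x = y := by
    intro x y e h
    obtain ⟨r, p, rfl⟩ := exists_eq_mul_of_isPushout hQ x
    obtain ⟨s, q, rfl⟩ := exists_eq_mul_of_isPushout hQ y
    obtain ⟨t, l, rfl⟩ := exists_eq_mul_of_isPushout hQ e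
    rw [mul_mul_mul_comm, ← map_mul, ← map_mul, mul_mul_mul_comm, ← map_mul, ← map_mul] at h
    -- The map to the quotient by `E` turns one equation in the pushout into two equations in `R`
    -- and `P`, where the common factors `t` and `l` cancel.
    have h' := congrArg (hQ.desc i' j' hw) h
    rw [hij, hij] at h'
    obtain ⟨m, n, h₁, h₂⟩ := (Con.eq E).1 h'
    dsimp only at h₁ h₂
    rw [mul_left_comm, mul_left_comm (θ n)] at h₁
    rw [mul_left_comm, mul_left_comm (θ'.hom m)] at h₂
    replace h₁ := mul_left_cancel h₁
    replace h₂ := mul_left_cancel h₂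
    obtain ⟨m', n', t, rfl, rfl, hmn⟩ := hθ m n r s h₁
    have h₃ : θ'.hom m' * p = θ'.hom n' * q := by
      apply mul_left_cancel (a := θ'.hom n)
      rw [mul_left_comm, h₂, ← mul_assoc, ← map_mul, mul_comm m', hmn, map_mul, mul_assoc]
    rw [map_mul, map_mul, hn, hn, mul_right_comm (j (θ' m')), mul_right_comm (j (θ' n'))]
    refine congrArg (· * i t) ((map_mul j.hom _ _).symm.trans ?_)
    exact (congrArg j.hom h₃).trans (map_mul j.hom _ _)
  exact
    { mul_left_cancel := fun e x y h => key x y e h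
      mul_right_cancel := fun e x y h => key x y e (by simpa [mul_comm] using h) }

/-- A homomorphism from a free commutative monoid to a cancellative monoid is integral if
divisibility by the images of coprime elements is independent. -/
theorem isIntegralMonoidHom_of_free [IsCancelMul R] {ι : Type*}
    (e : N ≃* Multiplicative (ι → ℕ)) (θ : N →* R)
    (hθ : ∀ m n r s, (∀ k, (e m).toAdd k = 0 ∨ (e n).toAdd k = 0) → θ m * r = θ n * s →
      θ n ∣ r) : IsIntegralMonoidHom θ := by
  apply isIntegralMonoidHom_of_equational
  intro m n r s h
  -- `c` is the greatest common divisor, the coordinatewise minimum; `θ c` cancels. For the coprime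
  -- parts, `r = θ n' * t` then forces `s = θ m' * t`, so the witnesses are `n'` and `m'` in swapped
  -- order.
  obtain ⟨c, m', n', rfl, rfl, hmn⟩ : ∃ c m' n', m = c * m' ∧ n = c * n' ∧
      ∀ k, (e m').toAdd k = 0 ∨ (e n').toAdd k = 0 := by
    set a := (e m).toAdd
    set b := (e n).toAdd
    refine ⟨e.symm (.ofAdd (a ⊓ b)), e.symm (.ofAdd fun k => a k - b k),
      e.symm (.ofAdd fun k => b k - a k), ?_, ?_, ?_⟩
    · apply e.injective
      rw [map_mul, e.apply_symm_apply, e.apply_symm_apply, ← ofAdd_add]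
      refine congrArg Multiplicative.ofAdd (funext fun k => ?_ : a = _)
      simp only [Pi.add_apply, Pi.inf_apply]
      omega
    · apply e.injective
      rw [map_mul, e.apply_symm_apply, e.apply_symm_apply, ← ofAdd_add]
      refine congrArg Multiplicative.ofAdd (funext fun k => ?_ : b = _)
      simp only [Pi.add_apply, Pi.inf_apply]
      omega
    · intro k
      simp only [e.apply_symm_apply, toAdd_ofAdd]
      omega
  rw [map_mul, map_mul, mul_assoc, mul_assoc] at h
  replace h := mul_left_cancel h
  obtain ⟨t, rfl⟩ := hθ m' n' r s hmn h
  refine ⟨n', m', t, rfl, ?_, by rw [mul_assoc, mul_comm m', mul_assoc]⟩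
  rw [mul_left_comm] at h
  exact (mul_left_cancel h).symm

end Integral

/-! ### The lemma of Farkas -/

/-- **Farkas' lemma** over an ordered field: a vector that is not a nonnegative combination of
finitely many given vectors is separated from them by a linear form. -/
theorem exists_linearMap_neg_of_not_nonneg_combination {k : Type*} [Field k] [LinearOrder k]
    [IsStrictOrderedRing k] {V : Type*} [AddCommGroup V] [Module k V] (n : ℕ) (s : Fin n → V)
    (g : V) (hg : ¬∃ c : Fin n → k, 0 ≤ c ∧ ∑ i, c i • s i = g) :
    ∃ f : V →ₗ[k] k, (∀ i, 0 ≤ f (s i)) ∧ f g < 0 := by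
  induction n generalizing g with
  | zero =>
    have hg0 : g ≠ 0 := fun h => hg ⟨0, le_rfl, by simp [h]⟩
    obtain ⟨f, hf⟩ := Module.Projective.exists_dual_ne_zero k hg0
    refine ⟨-(f g)⁻¹ • f, fun i => i.elim0, ?_⟩
    simp [hf]
  | succ n ih =>
    obtain ⟨f, hf, hfg⟩ := ih (fun i => s i.succ) g (by
      rintro ⟨c, hc, h⟩
      refine hg ⟨Fin.cons 0 c, fun i => ?_, by simp [Fin.sum_univ_succ, h]⟩
      refine Fin.cases ?_ (fun i => ?_) i
      · simp
      · simpa using hc i)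
    by_cases h0 : 0 ≤ f (s 0)
    · exact ⟨f, Fin.cases h0 hf, hfg⟩
    push Not at h0
    -- Projection onto the kernel of `f` along `s 0`. Were `π g` a nonnegative combination of the
    -- projected vectors, `g` would be one of the original vectors: the coefficient of `s 0` is
    -- nonnegative because `f (s 0)` and `f g` are negative and the other `f (s i)` are not.
    let π : V →ₗ[k] V := LinearMap.id - ((f (s 0))⁻¹ • f).smulRight (s 0)
    have hπ : ∀ x, π x = x - ((f (s 0))⁻¹ * f x) • s 0 := fun x => by simp [π]
    have hπ0 : π (s 0) = 0 := by rw [hπ, inv_mul_cancel₀ h0.ne, one_smul, sub_self]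
    obtain ⟨f', hf', hfg'⟩ := ih (fun i => π (s i.succ)) (π g) (by
      rintro ⟨c, hc, h⟩
      simp only [hπ, smul_sub, Finset.sum_sub_distrib, smul_smul, ← Finset.sum_smul] at h
      refine hg ⟨Fin.cons ((f (s 0))⁻¹ * f g - ∑ i, c i * ((f (s 0))⁻¹ * f (s i.succ))) c,
        fun i => ?_, ?_⟩
      · refine Fin.cases ?_ (fun i => ?_) i
        · have h1 : 0 ≤ (f (s 0))⁻¹ * f g :=
            mul_nonneg_of_nonpos_of_nonpos (inv_nonpos.2 h0.le) hfg.le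
          have h2 : ∑ i, c i * ((f (s 0))⁻¹ * f (s i.succ)) ≤ 0 :=
            Finset.sum_nonpos fun i _ => mul_nonpos_of_nonneg_of_nonpos (hc i)
              (mul_nonpos_of_nonpos_of_nonneg (inv_nonpos.2 h0.le) (hf i))
          simpa using h2.trans h1
        · simpa using hc i
      · rw [Fin.sum_univ_succ]
        simp only [Fin.cons_zero, Fin.cons_succ, sub_smul]
        rw [sub_eq_iff_eq_add] at h
        rw [h]
        abel)
    refine ⟨f' ∘ₗ π, Fin.cases ?_ hf', hfg'⟩
    simp [hπ0]

/-! ### Fs monoids -/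

section Fs

variable {R : Type u} [CommMonoid R]

/-- Saturation turns equality of powers into divisibility both ways, and sharpness forces the
quotient to be `1`. The resulting torsion-freeness makes the group completion a free abelian group.
-/
theorem IsFsMonoid.eq_of_pow_eq [Subsingleton Rˣ] (hR : IsFsMonoid R) {a b : R} {n : ℕ}
    (hn : n ≠ 0) (h : a ^ n = b ^ n) : a = b := by
  have := hR.integral
  obtain ⟨c, rfl⟩ := hR.saturated a b n (Nat.pos_of_ne_zero hn) h.dvd
  obtain ⟨d, hd⟩ := hR.saturated _ a n (Nat.pos_of_ne_zero hn) h.symm.dvd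
  have hcd : c * d = 1 := by
    apply mul_left_cancel (a := a)
    rw [mul_one, ← mul_assoc, ← hd]
  have hc : (Units.mk c d hcd (by rw [mul_comm, hcd])) = 1 := Subsingleton.elim _ _
  rw [show c = 1 from congrArg Units.val hc, mul_one]

theorem IsFsMonoid.isMulTorsionFree [Subsingleton Rˣ] (hR : IsFsMonoid R) :
    IsMulTorsionFree R :=
  ⟨fun _ hn _ _ h => hR.eq_of_pow_eq hn h⟩

/-- A sharp fs monoid embeds into a finite dimensional rational vector space. -/
theorem IsFsMonoid.exists_embedding [Subsingleton Rˣ] (hR : IsFsMonoid R) :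
    ∃ (d : ℕ) (φ : Additive R →+ (Fin d → ℚ)), Function.Injective φ := by
  have := hR.integral
  have := hR.fg
  have := hR.isMulTorsionFree
  let _ : AddCancelCommMonoid (Additive R) :=
    { (inferInstance : AddCommMonoid (Additive R)) with
      add_left_cancel := fun a b c h => add_left_cancel h }
  let b := Module.finBasis ℤ (Algebra.GrothendieckAddGroup (Additive R))
  let ψ : (Fin (Module.finrank ℤ (Algebra.GrothendieckAddGroup (Additive R))) → ℤ) →+
      (Fin (Module.finrank ℤ (Algebra.GrothendieckAddGroup (Additive R))) → ℚ) :=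
    (Int.castAddHom ℚ).compLeft _
  refine ⟨_, (ψ.comp b.equivFun.toAddEquiv.toAddMonoidHom).comp
    Algebra.GrothendieckAddGroup.of, ?_⟩
  refine Function.Injective.comp (g := fun x => ψ (b.equivFun x)) ?_
    Algebra.GrothendieckAddGroup.of_injective
  intro x y h
  apply b.equivFun.injective
  ext i
  have := congrFun h i
  simpa [ψ] using this

/-- Divisibility in a sharp fs monoid is detected by the homomorphisms to the nonnegative real
numbers. -/
theorem IsFsMonoid.exists_lt_of_not_dvd [Subsingleton Rˣ] (hR : IsFsMonoid R) {a b : R}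
    (hab : ¬a ∣ b) : ∃ v : Additive R →+ ℝ, v ∈ dualCone R ∧ v (.ofMul b) < v (.ofMul a) := by
  have := hR.integral
  obtain ⟨d, φ, hφ⟩ := hR.exists_embedding
  obtain ⟨s, hs⟩ := hR.fg.fg_top
  let g : Fin s.card → R := fun i => (s.equivFin.symm i : R)
  have hgs : ∀ x ∈ s, ∃ i, g i = x := fun x hx => ⟨s.equivFin ⟨x, hx⟩, by simp [g]⟩
  -- Farkas is applied over `ℚ` so that denominators can be cleared: a rational combination would
  -- give `b ^ N = a ^ N * ∏ g i ^ m i`, and saturation would give `a ∣ b`.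
  obtain ⟨f, hf, hfg⟩ := exists_linearMap_neg_of_not_nonneg_combination (k := ℚ) s.card
    (fun i => φ (.ofMul (g i))) (φ (.ofMul b) - φ (.ofMul a)) (by
      rintro ⟨c, hc, h⟩
      obtain ⟨N, hN, m, hm⟩ : ∃ N : ℕ, 0 < N ∧ ∃ m : Fin s.card → ℕ, ∀ i, N * c i = m i := by
        refine ⟨∏ i, (c i).den, Finset.prod_pos fun i _ => (c i).den_pos,
          fun i => (c i).num.toNat * ∏ j ∈ Finset.univ.erase i, (c j).den, fun i => ?_⟩
        rw [← Finset.mul_prod_erase _ _ (Finset.mem_univ i)]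
        have h1 : ((c i).num.toNat : ℚ) = (c i).num := by
          exact_mod_cast Int.toNat_of_nonneg (Rat.num_nonneg.2 (hc i))
        push_cast
        rw [h1, mul_right_comm, Rat.den_mul_eq_num]
      refine hab (hR.saturated a b N hN ⟨∏ i, g i ^ m i, ?_⟩)
      apply Additive.ofMul.injective
      apply hφ
      rw [ofMul_mul, map_add, ofMul_prod, map_sum, ofMul_pow, ofMul_pow, map_nsmul, map_nsmul]
      have h' := congrArg (fun x => (N : ℚ) • x) h
      simp only [Finset.smul_sum, smul_smul, hm, smul_sub] at h'
      simp only [ofMul_pow, map_nsmul, ← Nat.cast_smul_eq_nsmul ℚ]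
      rw [h']
      abel)
  refine ⟨(algebraMap ℚ ℝ).toAddMonoidHom.comp (f.toAddMonoidHom.comp φ), ?_, ?_⟩
  · intro x
    have hx : x.toMul ∈ Submonoid.closure (s : Set R) := by rw [hs]; trivial
    change 0 ≤ ((f (φ (.ofMul x.toMul)) : ℚ) : ℝ)
    refine Submonoid.closure_induction
      (motive := fun y _ => 0 ≤ ((f (φ (.ofMul y)) : ℚ) : ℝ)) ?_ ?_ ?_ hx
    · intro y hy
      obtain ⟨i, rfl⟩ := hgs y hy
      exact_mod_cast hf i
    · simp
    · intro y z _ _ hy hz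
      rw [ofMul_mul, map_add, map_add]
      push_cast
      exact add_nonneg hy hz
  · rw [map_sub, sub_neg] at hfg
    change ((f (φ (.ofMul b)) : ℚ) : ℝ) < ((f (φ (.ofMul a)) : ℚ) : ℝ)
    exact_mod_cast hfg

end Fs

/-! ### Saturation and splittings -/

/-- **Gordan's lemma**: the saturation of a finitely generated submonoid of a finitely generated
torsion free commutative group is finitely generated. -/
theorem AddSubmonoid.fg_of_isSaturation {G : Type*} [AddCommGroup G] [Module.Finite ℤ G]
    [Module.Free ℤ G] {S T : AddSubmonoid G} (hS : S.FG)
    (hT : ∀ g, g ∈ T ↔ ∃ n : ℕ, 0 < n ∧ n • g ∈ S) : T.FG := by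
  classical
  obtain ⟨s, rfl⟩ := hS
  let b := Module.finBasis ℤ G
  -- A box with finitely many lattice points, large enough for all combinations of `s` with
  -- coefficients in `[0, 1)`.
  let B : Set G := {g | ∀ j, |b.repr g j| ≤ ∑ x ∈ s, |b.repr x j|}
  have hB : B.Finite := by
    refine Set.Finite.of_finite_image (f := fun g => b.equivFun g) ?_ b.equivFun.injective.injOn
    refine (Set.finite_Icc (fun j => -∑ x ∈ s, |b.repr x j|)
      (fun j => ∑ x ∈ s, |b.repr x j|)).subset ?_
    rintro _ ⟨g, hg, rfl⟩
    exact ⟨fun j => (abs_le.1 (hg j)).1, fun j => (abs_le.1 (hg j)).2⟩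
  have hST : ∀ g ∈ s, g ∈ T := fun g hg =>
    (hT g).2 ⟨1, one_pos, by simpa using AddSubmonoid.subset_closure hg⟩
  refine AddSubmonoid.fg_iff _ |>.2 ⟨s ∪ (B ∩ T), le_antisymm ?_ ?_,
    s.finite_toSet.union (hB.subset Set.inter_subset_left)⟩
  · rw [AddSubmonoid.closure_le]
    rintro g (hg | hg)
    · exact hST g hg
    · exact hg.2
  · intro g hg
    obtain ⟨n, hn, hng⟩ := (hT g).1 hg
    obtain ⟨a, -, ha⟩ := AddSubmonoid.mem_closure_finset.1 hng
    -- Removing the integral parts of the coefficients `a x / n` leaves an element of the box that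
    -- still lies in the saturation.
    let r : G := g - ∑ x ∈ s, (a x / n) • x
    have hr : n • r = ∑ x ∈ s, (a x % n) • x := by
      rw [nsmul_sub, ← ha, Finset.smul_sum, ← Finset.sum_sub_distrib]
      refine Finset.sum_congr rfl fun x _ => ?_
      rw [sub_eq_iff_eq_add, ← mul_nsmul', ← add_nsmul, Nat.mod_add_div]
    have hrT : r ∈ T := (hT r).2 ⟨n, hn, by
      rw [hr]
      exact AddSubmonoid.sum_mem _ fun x hx =>
        AddSubmonoid.nsmul_mem _ (AddSubmonoid.subset_closure hx) _⟩
    have hrB : r ∈ B := by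
      intro j
      have h := congrArg (fun x => |b.repr x j|) hr
      simp only [map_nsmul, map_sum, Finsupp.coe_smul, Pi.smul_apply, Finsupp.coe_finsetSum,
        Finset.sum_apply, nsmul_eq_mul, abs_mul, Nat.abs_cast] at h
      refine le_of_mul_le_mul_left (a := (n : ℤ)) ?_ (by exact_mod_cast hn)
      rw [h, Finset.mul_sum]
      refine (Finset.abs_sum_le_sum_abs _ _).trans (Finset.sum_le_sum fun x _ => ?_)
      rw [Pi.mul_apply, Pi.natCast_apply, abs_mul, Nat.abs_cast]
      gcongr
      exact (Nat.mod_lt _ hn).le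
    have hg' : g = r + ∑ x ∈ s, (a x / n) • x := (sub_add_cancel _ _).symm
    rw [hg']
    have hsub : (s : Set G) ∪ (B ∩ T) ⊆ AddSubmonoid.closure ((s : Set G) ∪ (B ∩ T)) :=
      AddSubmonoid.subset_closure
    exact add_mem (hsub (Or.inr ⟨hrB, hrT⟩)) (AddSubmonoid.sum_mem _ fun x hx =>
      AddSubmonoid.nsmul_mem _ (hsub (Or.inl hx)) _)

/-! ### The saturated graph of a pair of homomorphisms -/

section Graph

variable {R A : Type u} [CommMonoid R] [CommMonoid A]

/-- The saturated graph of a pair of homomorphisms `ρ : A → R` and `u : A → ℝ`: the pairs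
`(r, c)`, a positive multiple of which is of the form `(ρ a, u a)`, with `c` in the group generated
by the values of `u`. -/
def satGraph (ρ : A →* R) (u : Additive A →+ ℝ) : Submonoid (R × Multiplicative ℝ) where
  carrier := {x | x.2.toAdd ∈ AddSubgroup.closure (Set.range u) ∧
    ∃ n : ℕ, 0 < n ∧ ∃ a : A, x.1 ^ n = ρ a ∧ n * x.2.toAdd = u (.ofMul a)}
  one_mem' := ⟨zero_mem _, 1, one_pos, 1, by simp, by simp⟩
  mul_mem' := by
    rintro x y ⟨hx, n, hn, a, ha, ha'⟩ ⟨hy, m, hm, b, hb, hb'⟩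
    refine ⟨add_mem hx hy, n * m, Nat.mul_pos hn hm, a ^ m * b ^ n, ?_, ?_⟩
    · rw [map_mul, map_pow, map_pow, ← ha, ← hb, Prod.fst_mul, mul_pow, pow_mul, ← pow_mul,
        ← pow_mul y.1, mul_comm n m]
    · rw [ofMul_mul, map_add, ofMul_pow, ofMul_pow, map_nsmul, map_nsmul, ← ha', ← hb',
        Prod.snd_mul, toAdd_mul, nsmul_eq_mul, nsmul_eq_mul]
      push_cast
      ring

theorem mem_satGraph {ρ : A →* R} {u : Additive A →+ ℝ} (a : A) :
    (ρ a, Multiplicative.ofAdd (u (.ofMul a))) ∈ satGraph ρ u :=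
  ⟨AddSubgroup.subset_closure ⟨_, rfl⟩, 1, one_pos, a, by simp, by simp⟩

/-- The saturated graph of homomorphisms from a finitely generated monoid to a sharp fs monoid and
to the real numbers is an fs monoid. -/
theorem isFsMonoid_satGraph [Subsingleton Rˣ] (hR : IsFsMonoid R) [Monoid.FG A] (ρ : A →* R)
    (u : Additive A →+ ℝ) : IsFsMonoid (satGraph ρ u) := by
  have := hR.integral
  have := hR.fg
  have := hR.isMulTorsionFree
  refine ⟨?_, inferInstance, ?_⟩
  · let _ : AddCancelCommMonoid (Additive R) :=
      { (inferInstance : AddCommMonoid (Additive R)) with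
        add_left_cancel := fun a b c h => add_left_cancel h }
    -- `Γ` is a lattice of finite rank, so Gordan's lemma applies in `R^gp × Γ`. Without confining
    -- the second component to `Γ`, division by arbitrary `n` could destroy finite generation.
    let Γ := AddSubgroup.closure (Set.range u)
    have hu : ∀ a, u a ∈ Γ := fun a => AddSubgroup.subset_closure ⟨a, rfl⟩
    have hΓ : Module.Finite ℤ Γ := by
      obtain ⟨t, ht⟩ := (Monoid.fg_iff_add_fg.1 ‹Monoid.FG A›).fg_top
      have hΓt : Γ = AddSubgroup.closure (u '' t) := by
        refine le_antisymm ((AddSubgroup.closure_le _).2 ?_)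
          (AddSubgroup.closure_mono (Set.image_subset_range _ _))
        rintro _ ⟨a, rfl⟩
        have ha : a ∈ AddSubmonoid.closure (t : Set (Additive A)) := by rw [ht]; trivial
        refine AddSubmonoid.closure_induction (motive := fun b _ =>
          u b ∈ AddSubgroup.closure (u '' t)) ?_ ?_ ?_ ha
        · exact fun b hb => AddSubgroup.subset_closure ⟨b, hb, rfl⟩
        · rw [map_zero]; exact zero_mem _
        · intro b c _ _ hb hc
          rw [map_add]; exact add_mem hb hc
      rw [Module.Finite.iff_addGroup_fg, AddGroup.fg_iff_addSubgroup_fg, AddSubgroup.fg_iff]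
      exact ⟨_, hΓt.symm, t.finite_toSet.image _⟩
    have : Module.Free ℤ Γ := Module.free_of_finite_type_torsion_free'
    let o : Additive R →+ Algebra.GrothendieckAddGroup (Additive R) :=
      Algebra.GrothendieckAddGroup.of
    have ho : Function.Injective o := Algebra.GrothendieckAddGroup.of_injective
    let φ : Additive A →+ Algebra.GrothendieckAddGroup (Additive R) × Γ :=
      AddMonoidHom.prod (o.comp (MonoidHom.toAdditive ρ)) (u.codRestrict Γ hu)
    let ψ : Additive (satGraph ρ u) →+ Algebra.GrothendieckAddGroup (Additive R) × Γ :=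
      { toFun := fun x => (o (.ofMul x.toMul.1.1), ⟨x.toMul.1.2.toAdd, x.toMul.2.1⟩)
        map_zero' := Prod.ext (map_zero o) rfl
        map_add' := fun x y => Prod.ext (map_add o _ _) rfl }
    have hψ : Function.Injective ψ := by
      intro x y h
      have h1 : x.toMul.1.1 = y.toMul.1.1 := ho (congrArg Prod.fst h)
      have h2 : x.toMul.1.2 = y.toMul.1.2 :=
        Multiplicative.toAdd.injective (Subtype.ext_iff.1 (congrArg Prod.snd h))
      exact congrArg Additive.ofMul (Subtype.ext (Prod.ext h1 h2))
    have hT : (AddMonoidHom.mrange ψ).FG := by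
      refine AddSubmonoid.fg_of_isSaturation (S := AddMonoidHom.mrange φ)
        ((AddMonoid.fg_iff_addSubmonoid_fg _).1 inferInstance) fun g => ⟨?_, ?_⟩
      · rintro ⟨x, rfl⟩
        obtain ⟨-, n, hn, a, ha, ha'⟩ := x.toMul.2
        refine ⟨n, hn, .ofMul a, Prod.ext ?_ (Subtype.ext ?_)⟩
        · exact (congrArg (fun z => o (.ofMul z)) ha).symm.trans (map_nsmul o _ _)
        · exact ha'.symm.trans (nsmul_eq_mul _ _).symm
      · rintro ⟨n, hn, a, ha⟩
        obtain ⟨⟨x, y⟩, hxy⟩ := (AddLocalization.addMonoidOf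
          (⊤ : AddSubmonoid (Additive R))).surj g.1
        have h1 : o (.ofMul (ρ a.toMul)) = n • g.1 := congrArg Prod.fst ha
        have hxy : g.1 + o y = o x := hxy
        have h2 : x.toMul ^ n = y.1.toMul ^ n * ρ a.toMul := by
          apply Additive.ofMul.injective
          apply ho
          rw [ofMul_mul, map_add, h1, ofMul_pow, ofMul_pow, map_nsmul, map_nsmul]
          change n • o x = n • o y + _
          rw [← hxy, nsmul_add, add_comm]
        -- A multiple of `g.1` lies in `R`, so `g.1` itself does, as `R` is saturated.
        obtain ⟨z, hz⟩ := hR.saturated _ _ n hn ⟨_, h2⟩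
        have hg : g.1 = o (.ofMul z) := by
          rw [← add_left_inj (o y), hxy, ← map_add]
          exact congrArg o (hz.trans (mul_comm _ _))
        have hz' : z ^ n = ρ a.toMul := by
          apply Additive.ofMul.injective
          apply ho
          rw [h1, hg, ofMul_pow, map_nsmul]
        refine ⟨.ofMul ⟨(z, .ofAdd (g.2 : ℝ)), g.2.2, n, hn, a.toMul, hz', ?_⟩,
          Prod.ext hg.symm rfl⟩
        exact ((nsmul_eq_mul _ _).symm.trans (congrArg (fun w => (w.2 : ℝ)) ha).symm)
    rw [Monoid.fg_iff_add_fg, AddMonoid.fg_def]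
    refine AddSubmonoid.FG.map_injective ψ hψ ?_
    rwa [← AddMonoidHom.mrange_eq_map]
  · rintro ⟨⟨r, c⟩, hx⟩ ⟨⟨s, d⟩, hy⟩ n hn ⟨⟨⟨t, e⟩, ht⟩, h⟩
    have h1 : s ^ n = r ^ n * t := congrArg (fun z => z.1.1) h
    have h2 : d ^ n = c ^ n * e := congrArg (fun z => z.1.2) h
    obtain ⟨q, rfl⟩ := hR.saturated r s n hn ⟨t, h1⟩
    have h3 : q ^ n = t := by
      rw [mul_pow] at h1
      exact mul_left_cancel h1
    have h4 : (d / c) ^ n = e := by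
      rw [div_pow, h2, mul_div_cancel_left]
    obtain ⟨-, m, hm, a, ha, ha'⟩ := ht
    refine ⟨⟨(q, d / c), ?_, n * m, Nat.mul_pos hn hm, a, ?_, ?_⟩, ?_⟩
    · exact sub_mem hy.1 hx.1
    · rw [← ha, ← h3, pow_mul]
    · rw [← ha', ← h4, toAdd_pow, nsmul_eq_mul]
      push_cast
      ring
    · apply Subtype.ext
      simp

end Graph

/-! ### Splitting off the units -/

/-- The quotient map of a commutative monoid to its quotient by the units has a section if the
monoid is cancellative and the quotient is an fs monoid. -/
theorem exists_section_associates {M : Type u} [CommMonoid M] [IsCancelMul M]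
    (hM : IsFsMonoid (Associates M)) :
    ∃ s : Associates M →* M, ∀ r, Associates.mk (s r) = r := by
  have : Subsingleton (Associates M)ˣ := inferInstance
  have := hM.integral
  have := hM.fg
  have := hM.isMulTorsionFree
  let _ : AddCancelCommMonoid (Additive (Associates M)) :=
    { (inferInstance : AddCommMonoid (Additive (Associates M))) with
      add_left_cancel := fun a b c h => add_left_cancel h }
  let o : Additive (Associates M) →+ Algebra.GrothendieckAddGroup (Additive (Associates M)) :=
    Algebra.GrothendieckAddGroup.of
  have ho : Function.Injective o := Algebra.GrothendieckAddGroup.of_injective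
  let o' : Additive M →+ Algebra.GrothendieckAddGroup (Additive M) :=
    Algebra.GrothendieckAddGroup.of
  have ho' : Function.Injective o' := Algebra.GrothendieckAddGroup.of_injective
  let mk : Additive M →+ Additive (Associates M) := MonoidHom.toAdditive Associates.mkMonoidHom
  let π : Algebra.GrothendieckAddGroup (Additive M) →+
      Algebra.GrothendieckAddGroup (Additive (Associates M)) :=
    Algebra.GrothendieckAddGroup.lift (o.comp mk)
  have hπ : ∀ m, π (o' m) = o (mk m) := fun m =>
    DFunLike.congr_fun (Algebra.GrothendieckAddGroup.lift.symm_apply_apply (o.comp mk)) m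
  have hπs : Function.Surjective π := by
    intro g
    obtain ⟨⟨x, y⟩, hxy⟩ := (AddLocalization.addMonoidOf
      (⊤ : AddSubmonoid (Additive (Associates M)))).surj g
    have hxy : g + o y = o x := hxy
    obtain ⟨a, ha⟩ := Associates.mk_surjective x.toMul
    obtain ⟨b, hb⟩ := Associates.mk_surjective y.1.toMul
    refine ⟨o' (.ofMul a) - o' (.ofMul b), ?_⟩
    rw [map_sub, hπ, hπ, sub_eq_iff_eq_add]
    have ha : mk (.ofMul a) = x := ha
    have hb : mk (.ofMul b) = y := hb
    rw [ha, hb, hxy]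
  -- The group completion of the sharp quotient is finitely generated and torsion free, hence free,
  -- so `π` splits. The splitting maps the quotient monoid into `M`, since an element of `M^gp` over
  -- the class of `m` differs from `m` by a unit of `M`.
  obtain ⟨σ, hσ⟩ := Module.projective_lifting_property π.toIntLinearMap LinearMap.id hπs
  have hσ' : ∀ g, π (σ g) = g := fun g => LinearMap.congr_fun hσ g
  have key : ∀ r : Associates M, ∃ m : M, Associates.mk m = r ∧ o' (.ofMul m) = σ (o (.ofMul r)) := by
    intro r
    obtain ⟨m, rfl⟩ := Associates.mk_surjective r
    obtain ⟨⟨x, y⟩, hxy⟩ := (AddLocalization.addMonoidOf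
      (⊤ : AddSubmonoid (Additive M))).surj (σ (o (.ofMul (Associates.mk m))))
    have hxy : σ (o (.ofMul (Associates.mk m))) + o' y = o' x := hxy
    have h := congrArg π hxy
    rw [map_add, hσ', hπ, hπ, ← map_add] at h
    have h' : Associates.mk (m * y.1.toMul) = Associates.mk x.toMul := ho h
    obtain ⟨v, hv⟩ := Associates.mk_eq_mk_iff_associated.1 h'
    refine ⟨m * v, Associates.mk_eq_mk_iff_associated.2 ⟨v⁻¹, by simp⟩, ?_⟩
    rw [← add_left_inj (o' y), hxy, ← map_add]
    refine congrArg o' ?_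
    rw [← ofMul_toMul x, ← hv]
    exact congrArg Additive.ofMul (mul_right_comm _ _ _)
  choose s hs hs' using key
  refine ⟨⟨⟨s, ?_⟩, ?_⟩, hs⟩
  · apply Additive.ofMul.injective
    apply ho'
    rw [hs', ofMul_one, map_zero, map_zero, ofMul_one, map_zero]
  · intro a b
    apply Additive.ofMul.injective
    apply ho'
    dsimp only
    rw [hs', ofMul_mul, map_add, map_add, ofMul_mul, map_add, hs', hs']

/-! ### The dual cone -/

section DualCone

variable {P Q N R : Type u} [CommMonoid P] [CommMonoid Q] [CommMonoid N] [CommMonoid R]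

theorem mem_dualCone_of_closure {s : Set R} (hs : Submonoid.closure s = ⊤)
    {v : Additive R →+ ℝ} (hv : ∀ a ∈ s, 0 ≤ v (.ofMul a)) : v ∈ dualCone R := by
  intro a
  have ha : a.toMul ∈ Submonoid.closure s := by rw [hs]; trivial
  refine Submonoid.closure_induction (motive := fun b _ => 0 ≤ v (.ofMul b)) hv ?_ ?_ ha
  · simp
  · intro b c _ _ hb hc
    rw [ofMul_mul, map_add]
    exact add_nonneg hb hc

/-- The set of elements of the dual cone that are bounded by a multiple of `w`: it is the smallest
face that contains `w`, for `w` in the dual cone. -/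
def boundedFace (w : Additive Q →+ ℝ) :
    PointedCone ℝ (Additive Q →+ ℝ) where
  carrier := {v | v ∈ dualCone Q ∧ ∃ c : ℝ, 0 ≤ c ∧ ∀ a, v a ≤ c * w a}
  add_mem' := by
    rintro v v' ⟨hv, c, hc, h⟩ ⟨hv', c', hc', h'⟩
    exact ⟨add_mem hv hv', c + c', add_nonneg hc hc', fun a => by
      rw [add_mul]; exact add_le_add (h a) (h' a)⟩
  zero_mem' := ⟨zero_mem _, 0, le_rfl, fun a => by simp⟩
  smul_mem' := by
    rintro k v ⟨hv, c, hc, h⟩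
    refine ⟨Submodule.smul_mem _ k hv, k * c, mul_nonneg k.2 hc, fun a => ?_⟩
    rw [mul_assoc]
    exact mul_le_mul_of_nonneg_left (h a) k.2

theorem mem_boundedFace {w : Additive Q →+ ℝ} (hw : w ∈ dualCone Q) : w ∈ boundedFace w :=
  ⟨hw, 1, zero_le_one, fun a => by simp⟩

/-- For `a > 0` and `y ≥ 0`, a bound of `a x + y` by `c w` bounds `x` by `a⁻¹ c w`. -/
theorem isFaceOf_boundedFace (w : Additive Q →+ ℝ) :
    (boundedFace w).IsFaceOf (dualCone Q) where
  le _ hv := hv.1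
  mem_of_smul_add_mem := by
    rintro x y a hx hy ha ⟨-, c, hc, h⟩
    refine ⟨hx, a⁻¹ * c, by positivity, fun b => ?_⟩
    have h1 : a * x b + y b ≤ c * w b := h b
    have h2 := hy b
    rw [mul_assoc, ← div_eq_inv_mul, le_div_iff₀ ha]
    linarith

/-- Let `R` be a sharp fs monoid with homomorphisms from `Q` and from the free monoid `N` such that
the dual cone of `R` is the fibre product of the dual cones of `Q` and `N` over that of `P`. If the
preimages in the dual cone of `N` of images of faces of the dual cone of `Q` are faces, then the
homomorphism `N → R` is integral. -/
theorem isIntegralMonoidHom_of_isFaceOf [Subsingleton Rˣ] (hR : IsFsMonoid R)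
    (hN : IsFreeCommMonoid N) (f : P →* Q) (g : P →* N) (q : Q →* R) (p : N →* R)
    (hfg : q.comp f = p.comp g)
    (hgen : ∀ r : R, ∃ n : ℕ, 0 < n ∧ ∃ a b, r ^ n = q a * p b)
    (hlift : ∀ v ∈ dualCone Q, ∀ w ∈ dualCone N, dualMap f v = dualMap g w →
      ∃ z ∈ dualCone R, dualMap q z = v ∧ dualMap p z = w)
    (hface : ∀ F : PointedCone ℝ (Additive Q →+ ℝ), F.IsFaceOf (dualCone Q) →
      (PointedCone.comap (dualMap g) (PointedCone.map (dualMap f) F) ⊓ dualCone N).IsFaceOf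
        (dualCone N)) :
    IsIntegralMonoidHom p := by
  classical
  have := hR.integral
  obtain ⟨d, ⟨e⟩⟩ := hN
  obtain ⟨T, hT⟩ := hR.fg.fg_top
  refine isIntegralMonoidHom_of_free e p fun m n r s hmn h => ?_
  by_contra hdvd
  obtain ⟨v, hv, hlt⟩ := hR.exists_lt_of_not_dvd hdvd
  let pr (A : Fin d → Prop) : N →* N :=
    { toFun := fun x => e.symm (.ofAdd fun k => if A k then (e x).toAdd k else 0)
      map_one' := by
        rw [map_one]
        simp only [toAdd_one, Pi.zero_apply, ite_self]
        exact map_one e.symm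
      map_mul' := fun x y => by
        rw [← map_mul, ← ofAdd_add]
        congr 2
        funext k
        by_cases hk : A k <;> simp [hk] }
  have hpr : ∀ A x, pr A x * pr (fun k => ¬A k) x = x := by
    intro A x
    apply e.injective
    rw [map_mul]
    change e (e.symm _) * e (e.symm _) = _
    rw [e.apply_symm_apply, e.apply_symm_apply, ← ofAdd_add]
    refine congrArg Multiplicative.ofAdd (funext fun k => ?_ : _ = (e x).toAdd)
    by_cases hk : A k <;> simp [hk]
  have hpr1 : ∀ (A : Fin d → Prop) x, (∀ k, A k → (e x).toAdd k = 0) → pr A x = 1 := by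
    intro A x hx
    rw [← map_one e.symm]
    refine congrArg e.symm (congrArg Multiplicative.ofAdd
      (funext fun k => ?_ : (fun k => if A k then (e x).toAdd k else 0) = 0))
    by_cases hk : A k
    · simp [hk, hx k hk]
    · simp [hk]
  -- The coordinates outside the support of `m`. Thus `w₁`, which only sees these, kills `m`; `w₂`,
  -- which only sees the support of `m`, kills `n` by coprimality.
  let A : Fin d → Prop := fun k => (e m).toAdd k = 0
  -- Induction on the number of generators on which `v` does not vanish.
  suffices H : ∀ (c : ℕ) (v : Additive R →+ ℝ), v ∈ dualCone R →
      (T.filter fun t => v (.ofMul t) ≠ 0).card = c → v (.ofMul (p n)) ≤ v (.ofMul r) from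
    absurd (H _ v hv rfl) (not_le.2 hlt)
  clear v hv hlt
  intro c
  induction c using Nat.strong_induction_on with
  | _ c ih =>
  intro v hv hc
  have hqv : dualMap q v ∈ dualCone Q := fun a => hv _
  have hpv : dualMap p v ∈ dualCone N := fun a => hv _
  let w₁ := dualMap (pr A) (dualMap p v)
  let w₂ := dualMap (pr fun k => ¬A k) (dualMap p v)
  have hw : w₁ + w₂ = dualMap p v := by
    refine DFunLike.ext _ _ fun x => ?_
    change dualMap p v (.ofMul (pr A x.toMul)) +
      dualMap p v (.ofMul (pr (fun k => ¬A k) x.toMul)) = dualMap p v x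
    rw [← map_add, ← ofMul_mul, hpr]
    rfl
  have hq : ∀ b, dualMap q v (.ofMul b) = v (.ofMul (q b)) := fun b => rfl
  have hwp : ∀ b, w₁ (.ofMul b) + w₂ (.ofMul b) = v (.ofMul (p b)) := fun b => by
    rw [← AddMonoidHom.add_apply, hw]
    rfl
  have hw₁ : w₁ ∈ dualCone N := fun a => hpv _
  have hw₂ : w₂ ∈ dualCone N := fun a => hpv _
  have hw₁m : w₁ (.ofMul m) = 0 := by
    change dualMap p v (.ofMul (pr A m)) = 0
    rw [hpr1 A m fun k hk => hk, ofMul_one, map_zero]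
  have hw₂n : w₂ (.ofMul n) = 0 := by
    change dualMap p v (.ofMul (pr _ n)) = 0
    rw [hpr1 _ n fun k hk => (hmn k).resolve_left hk, ofMul_one, map_zero]
  -- `v ∘ q` and `v ∘ p` have the same restriction to `P`, so `v ∘ p` lies in the preimage of the
  -- image of the smallest face containing `v ∘ q`. That preimage is a face, so it also contains the
  -- summand `w₁`.
  have hmem : w₁ + w₂ ∈ PointedCone.comap (dualMap g)
      (PointedCone.map (dualMap f) (boundedFace (dualMap q v))) ⊓ dualCone N := by
    rw [hw]
    refine ⟨⟨_, mem_boundedFace hqv, ?_⟩, hpv⟩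
    refine DFunLike.ext _ _ fun a => ?_
    exact congrArg (fun k : P →* R => v (.ofMul (k a.toMul))) hfg
  obtain ⟨⟨u, ⟨hu, c', hc', huv⟩, hu'⟩, -⟩ :=
    (hface _ (isFaceOf_boundedFace _)).mem_of_add_mem_left hw₁ hw₂ hmem
  obtain ⟨v', hv', hqv', hpv'⟩ := hlift u hu w₁ hw₁ hu'
  have hv'p : ∀ b, v' (.ofMul (p b)) = w₁ (.ofMul b) := fun b =>
    DFunLike.congr_fun hpv' (.ofMul b)
  have hv'q : ∀ b, v' (.ofMul (q b)) = u (.ofMul b) := fun b =>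
    DFunLike.congr_fun hqv' (.ofMul b)
  -- A positive power of `a` is `q b * p b'`; there `u ≤ c' (v ∘ q)` and `w₁ ≤ v ∘ p`, so `v'`
  -- vanishes together with `v`.
  have hzero : ∀ a, v a = 0 → v' a = 0 := by
    intro a ha
    obtain ⟨k, hk, b, b', hb⟩ := hgen a.toMul
    have hb' : k • a = .ofMul (q b) + .ofMul (p b') := congrArg Additive.ofMul hb
    have h1 := congrArg v hb'
    have h2 := congrArg v' hb'
    rw [map_nsmul, ha, smul_zero, map_add] at h1
    rw [map_nsmul, map_add, hv'q, hv'p] at h2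
    have h3 := hv (.ofMul (q b))
    have h4 := hv (.ofMul (p b'))
    have h5 := huv (.ofMul b)
    rw [hq] at h5
    have h6 := hwp b'
    have h7 := hw₂ (.ofMul b')
    have h8 : v (.ofMul (q b)) = 0 := by linarith
    rw [h8, mul_zero] at h5
    have h9 := hv' a
    have h10 : (k : ℝ) * v' a ≤ 0 := by
      rw [← nsmul_eq_mul, h2]; linarith
    exact le_antisymm (nonpos_of_mul_nonpos_right h10 (by exact_mod_cast hk)) h9
  have hv'le : v' (.ofMul (p n)) ≤ v' (.ofMul r) := by
    have h1 := congrArg (fun x => v' (.ofMul x)) h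
    simp only [ofMul_mul, map_add] at h1
    rw [hv'p m, hw₁m, zero_add] at h1
    rw [h1]
    exact le_add_of_nonneg_right (hv' _)
  -- If `v'` vanishes identically, then `v (p n) = w₁ n + w₂ n = 0`.
  by_cases hT0 : (T.filter fun t => v' (.ofMul t) ≠ 0) = ∅
  · have h0 : ∀ a, v' a = 0 := by
      intro a
      refine le_antisymm ?_ (hv' a)
      have : -v' ∈ dualCone R := mem_dualCone_of_closure hT fun t ht => by
        have := Finset.filter_eq_empty_iff.1 hT0 ht
        push Not at this
        simp [this]
      simpa using this a
    have h1 := hwp n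
    rw [hw₂n, ← hv'p, h0, zero_add] at h1
    rw [← h1]
    exact hv _
  -- `l` is the largest multiple for which `v - l v'` is still nonnegative. This form vanishes at
  -- the minimizing generator `t`, where `v` does not, and by `hzero` it keeps all zeros of `v`.
  · obtain ⟨t, ht, hmin⟩ := Finset.exists_min_image _
      (fun t => v (.ofMul t) / v' (.ofMul t)) (Finset.nonempty_iff_ne_empty.2 hT0)
    rw [Finset.mem_filter] at ht
    set l := v (.ofMul t) / v' (.ofMul t) with hl
    have hl0 : 0 ≤ l := div_nonneg (hv _) (hv' _)
    let v₁ : Additive R →+ ℝ := v - l • v'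
    have hv₁ : ∀ a, v₁ a = v a - l * v' a := fun a => rfl
    have hv₁mem : v₁ ∈ dualCone R := by
      refine mem_dualCone_of_closure hT fun a ha => ?_
      rw [hv₁, sub_nonneg]
      by_cases h0 : v' (.ofMul a) = 0
      · rw [h0, mul_zero]; exact hv _
      · have h1 := hmin a (Finset.mem_filter.2 ⟨ha, h0⟩)
        rwa [le_div_iff₀ (lt_of_le_of_ne (hv' _) (Ne.symm h0))] at h1
    have hcard : (T.filter fun t => v₁ (.ofMul t) ≠ 0).card < c := by
      rw [← hc]
      refine Finset.card_lt_card ⟨fun a ha => ?_, fun hsub => ?_⟩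
      · rw [Finset.mem_filter] at ha ⊢
        refine ⟨ha.1, fun h0 => ha.2 ?_⟩
        rw [hv₁, h0, hzero _ h0, mul_zero, sub_zero]
      · have h1 := hsub (Finset.mem_filter.2 ⟨ht.1, fun h0 => ht.2 (hzero _ h0)⟩)
        refine (Finset.mem_filter.1 h1).2 ?_
        rw [hv₁, hl, div_mul_cancel₀ _ ht.2, sub_self]
    have h1 := ih _ hcard v₁ hv₁mem rfl
    rw [hv₁, hv₁] at h1
    have h2 := mul_le_mul_of_nonneg_left hv'le hl0
    linarith

end DualCone

/-! ### Étale local properties -/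

section EtaleLocally

variable {𝒳 : BasedCategory.{u, u + 1} Scheme.{u}}

namespace IsFiberedInGroupoids

/-- The isomorphism `e` stands for the equality of the base of the lift with `V`, which avoids
transport along equalities of schemes. -/
theorem exists_lift (h𝒳 : IsFiberedInGroupoids 𝒳) (y : 𝒳.obj) {V : Scheme.{u}}
    (f : V ⟶ 𝒳.p.obj y) : ∃ (z : 𝒳.obj) (φ : z ⟶ y) (e : 𝒳.p.obj z ≅ V),
      𝒳.p.map φ = e.hom ≫ f := by
  have := h𝒳.isFibered
  obtain ⟨z, φ, hφ⟩ := IsPreFibered.exists_isCartesian 𝒳.p rfl f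
  refine ⟨z, φ, eqToIso (IsHomLift.domain_eq 𝒳.p f φ), ?_⟩
  have := IsHomLift.fac' 𝒳.p f φ
  simpa using this

theorem exists_fac (h𝒳 : IsFiberedInGroupoids 𝒳) {w y z : 𝒳.obj} (φ : z ⟶ y) (ψ : w ⟶ y)
    (g : 𝒳.p.obj w ⟶ 𝒳.p.obj z) (hg : g ≫ 𝒳.p.map φ = 𝒳.p.map ψ) :
    ∃ χ : w ⟶ z, χ ≫ φ = ψ ∧ 𝒳.p.map χ = g := by
  have := h𝒳.isStronglyCartesian φ
  refine ⟨Functor.IsStronglyCartesian.map 𝒳.p (𝒳.p.map φ) φ hg.symm ψ,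
    Functor.IsStronglyCartesian.fac 𝒳.p (𝒳.p.map φ) φ hg.symm ψ, ?_⟩
  have := IsHomLift.fac' 𝒳.p g (Functor.IsStronglyCartesian.map 𝒳.p (𝒳.p.map φ) φ hg.symm ψ)
  simpa using this

/-- Two points in objects over `y` with the same image in `y` come from a point in an object over
both. -/
theorem exists_common_refinement (h𝒳 : IsFiberedInGroupoids 𝒳) {y z₁ z₂ : 𝒳.obj} (φ₁ : z₁ ⟶ y)
    (φ₂ : z₂ ⟶ y) (s₁ : 𝒳.p.obj z₁) (s₂ : 𝒳.p.obj z₂)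
    (hs : 𝒳.p.map φ₁ s₁ = 𝒳.p.map φ₂ s₂) :
    ∃ (w : 𝒳.obj) (ψ₁ : w ⟶ z₁) (ψ₂ : w ⟶ z₂) (s : 𝒳.p.obj w), ψ₁ ≫ φ₁ = ψ₂ ≫ φ₂ ∧
      𝒳.p.map ψ₁ s = s₁ ∧ 𝒳.p.map ψ₂ s = s₂ := by
  obtain ⟨t, ht₁, ht₂⟩ := Scheme.Pullback.exists_preimage_pullback s₁ s₂ hs
  obtain ⟨w, ψ₁, e, hψ₁⟩ := h𝒳.exists_lift z₁ (pullback.fst (𝒳.p.map φ₁) (𝒳.p.map φ₂))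
  obtain ⟨ψ₂, h₂, hψ₂⟩ := h𝒳.exists_fac φ₂ (ψ₁ ≫ φ₁)
    (e.hom ≫ pullback.snd (𝒳.p.map φ₁) (𝒳.p.map φ₂)) (by
      rw [Category.assoc, ← pullback.condition, Functor.map_comp, hψ₁, Category.assoc])
  refine ⟨w, ψ₁, ψ₂, e.inv t, h₂.symm, ?_, ?_⟩
  · rw [hψ₁, ← Scheme.Hom.comp_apply, e.inv_hom_id_assoc, ht₁]
  · rw [hψ₂, ← Scheme.Hom.comp_apply, e.inv_hom_id_assoc, ht₂]

end IsFiberedInGroupoids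

/-- Étale morphisms are open; openness is kept because it makes glued functions locally constant. -/
theorem exists_mem_of_mem_etaleTopology {S : Scheme.{u}} {R : Sieve S}
    (hR : R ∈ Scheme.etaleTopology S) (s : S) :
    ∃ (V : Scheme.{u}) (f : V ⟶ S) (v : V), R f ∧ IsOpenMap f ∧ f v = s := by
  obtain ⟨𝒰, h𝒰⟩ := Scheme.mem_grothendieckTopology_iff.1 hR
  obtain ⟨i, v, hv⟩ := ((Scheme.ofArrows_mem_precoverage_iff _).1 𝒰.mem₀).1 s
  have : Etale (𝒰.f i) := 𝒰.map_prop i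
  exact ⟨𝒰.X i, 𝒰.f i, v, h𝒰 _ _ ⟨i⟩, (𝒰.f i).isOpenMap, hv⟩

theorem IsFiberedInGroupoids.exists_lift_mem (h𝒳 : IsFiberedInGroupoids 𝒳) {y : 𝒳.obj}
    {R : Sieve (𝒳.p.obj y)} (hR : R ∈ Scheme.etaleTopology (𝒳.p.obj y)) (s : 𝒳.p.obj y) :
    ∃ (z : 𝒳.obj) (φ : z ⟶ y) (t : 𝒳.p.obj z), R (𝒳.p.map φ) ∧ IsOpenMap (𝒳.p.map φ) ∧
      𝒳.p.map φ t = s := by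
  obtain ⟨V, f, v, hf, ho, hv⟩ := exists_mem_of_mem_etaleTopology hR s
  obtain ⟨z, φ, e, hφ⟩ := h𝒳.exists_lift y f
  refine ⟨z, φ, e.inv v, ?_, ?_, ?_⟩
  · rw [hφ]; exact R.downward_closed hf _
  · rw [hφ]
    exact ho.comp (Scheme.homeoOfIso e).isOpenMap
  · rw [hφ, ← Scheme.Hom.comp_apply, e.inv_hom_id_assoc, hv]

/-- A geometric point lifts through some member of any étale covering. Applied to the isomorphism
from `Spec K`, this splits the covering, so the sieve contains the identity. -/
theorem eq_top_of_mem_etaleTopology {S : Scheme.{u}} {K : Type u} [Field K] [IsAlgClosed K]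
    (e : S ≅ Spec (CommRingCat.of K)) {R : Sieve S} (hR : R ∈ Scheme.etaleTopology S) : R = ⊤ := by
  obtain ⟨V, f, hf, v, hv⟩ := (Scheme.geometricFiber K).jointly_surjective R hR e.inv
  rw [← Sieve.id_mem_iff_eq_top]
  let v' : Spec (CommRingCat.of K) ⟶ V := v
  have hv : v' ≫ f = e.inv := hv
  have : 𝟙 S = (e.hom ≫ v') ≫ f := by rw [Category.assoc, hv, e.hom_inv_id]
  rw [this]
  exact R.downward_closed hf _

namespace EtaleLocally

variable {x : 𝒳.obj} {A B : ∀ y : 𝒳.obj, (y ⟶ x) → Prop}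

theorem of_forall (h : ∀ y φ, A y φ) : EtaleLocally 𝒳 x A :=
  ⟨⊤, GrothendieckTopology.top_mem _ _, fun y φ _ => h y φ⟩

theorem mono (hA : EtaleLocally 𝒳 x A) (h : ∀ y φ, A y φ → B y φ) : EtaleLocally 𝒳 x B := by
  obtain ⟨R, hR, h'⟩ := hA
  exact ⟨R, hR, fun y φ hφ => h y φ (h' y φ hφ)⟩

theorem and (hA : EtaleLocally 𝒳 x A) (hB : EtaleLocally 𝒳 x B) :
    EtaleLocally 𝒳 x fun y φ => A y φ ∧ B y φ := by
  obtain ⟨R, hR, h⟩ := hA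
  obtain ⟨R', hR', h'⟩ := hB
  exact ⟨R ⊓ R', GrothendieckTopology.intersection_covering _ hR hR',
    fun y φ hφ => ⟨h y φ hφ.1, h' y φ hφ.2⟩⟩

theorem restrict (hA : EtaleLocally 𝒳 x A) {z : 𝒳.obj} (ψ : z ⟶ x) :
    EtaleLocally 𝒳 z fun y φ => A y (φ ≫ ψ) := by
  obtain ⟨R, hR, h⟩ := hA
  refine ⟨R.pullback (𝒳.p.map ψ), GrothendieckTopology.pullback_stable _ _ hR, fun y φ hφ => ?_⟩
  apply h
  rw [Functor.map_comp]
  exact hφ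

theorem exists_of_mem (h𝒳 : IsFiberedInGroupoids 𝒳) (hA : EtaleLocally 𝒳 x A)
    (s : 𝒳.p.obj x) : ∃ (y : 𝒳.obj) (φ : y ⟶ x) (t : 𝒳.p.obj y), A y φ ∧
      IsOpenMap (𝒳.p.map φ) ∧ 𝒳.p.map φ t = s := by
  obtain ⟨R, hR, h⟩ := hA
  obtain ⟨z, φ, t, hφ, ho, ht⟩ := h𝒳.exists_lift_mem hR s
  exact ⟨z, φ, t, h z φ hφ, ho, ht⟩

theorem id_of_iso {K : Type u} [Field K] [IsAlgClosed K]
    (e : 𝒳.p.obj x ≅ Spec (CommRingCat.of K)) (hA : EtaleLocally 𝒳 x A) : A x (𝟙 x) := by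
  obtain ⟨R, hR, h⟩ := hA
  apply h
  rw [eq_top_of_mem_etaleTopology e hR]
  trivial

/-- A property that holds étale locally on the members of a covering holds étale locally. -/
theorem bind (h𝒳 : IsFiberedInGroupoids 𝒳) {R : Sieve (𝒳.p.obj x)}
    (hR : R ∈ Scheme.etaleTopology (𝒳.p.obj x))
    (h : ∀ (y : 𝒳.obj) (φ : y ⟶ x), R (𝒳.p.map φ) →
      EtaleLocally 𝒳 y fun z ψ => A z (ψ ≫ φ)) : EtaleLocally 𝒳 x A := by
  -- Quantifying over all `φ` whose image factors through `f` makes this downward closed without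
  -- choosing lifts.
  let R' : Sieve (𝒳.p.obj x) :=
    { arrows := fun V f => ∀ (y : 𝒳.obj) (φ : y ⟶ x) (g : 𝒳.p.obj y ⟶ V),
        g ≫ f = 𝒳.p.map φ → A y φ
      downward_closed := fun {V W} f hf g y φ k hk => hf y φ (k ≫ g) (by rw [Category.assoc, hk]) }
  refine ⟨R', ?_, fun y φ hφ => hφ y φ (𝟙 _) (Category.id_comp _)⟩
  refine GrothendieckTopology.transitive _ hR R' fun V f hf => ?_
  obtain ⟨z, φ, e, hφ⟩ := h𝒳.exists_lift x f
  obtain ⟨R₁, hR₁, h₁⟩ := h z φ (by rw [hφ]; exact R.downward_closed hf _)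
  have h₂ := GrothendieckTopology.pullback_stable _ e.inv hR₁
  refine GrothendieckTopology.superset_covering _ (fun W g hg => ?_) h₂
  intro y ψ k hk
  obtain ⟨χ, hχ, hχ'⟩ := h𝒳.exists_fac φ ψ (k ≫ g ≫ e.inv) (by
    rw [hφ, ← hk]; simp)
  rw [← hχ]
  apply h₁
  rw [hχ']
  exact R₁.downward_closed hg k

end EtaleLocally

/-- Compatible families of locally constant functions on a covering sieve glue. -/
theorem IsFiberedInGroupoids.exists_locallyConstant (h𝒳 : IsFiberedInGroupoids 𝒳) {y : 𝒳.obj}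
    {R : Sieve (𝒳.p.obj y)} (hR : R ∈ Scheme.etaleTopology (𝒳.p.obj y)) {E : Type*}
    (c : ∀ {z : 𝒳.obj} (φ : z ⟶ y), R (𝒳.p.map φ) → LocallyConstant (𝒳.p.obj z) E)
    (hc : ∀ {z w : 𝒳.obj} (φ : z ⟶ y) (ψ : w ⟶ z) (hφ : R (𝒳.p.map φ))
      (hψ : R (𝒳.p.map (ψ ≫ φ))) (s : 𝒳.p.obj w), c (ψ ≫ φ) hψ s = c φ hφ (𝒳.p.map ψ s)) :
    ∃ d : LocallyConstant (𝒳.p.obj y) E, ∀ {z : 𝒳.obj} (φ : z ⟶ y) (hφ : R (𝒳.p.map φ))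
      (s : 𝒳.p.obj z), d (𝒳.p.map φ s) = c φ hφ s := by
  have key : ∀ {z₁ z₂ : 𝒳.obj} (φ₁ : z₁ ⟶ y) (φ₂ : z₂ ⟶ y) (h₁ : R (𝒳.p.map φ₁))
      (h₂ : R (𝒳.p.map φ₂)) (s₁ : 𝒳.p.obj z₁) (s₂ : 𝒳.p.obj z₂),
      𝒳.p.map φ₁ s₁ = 𝒳.p.map φ₂ s₂ → c φ₁ h₁ s₁ = c φ₂ h₂ s₂ := by
    intro z₁ z₂ φ₁ φ₂ h₁ h₂ s₁ s₂ hs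
    obtain ⟨w, ψ₁, ψ₂, s, hψ, rfl, rfl⟩ := h𝒳.exists_common_refinement φ₁ φ₂ s₁ s₂ hs
    have h₃ : R (𝒳.p.map (ψ₁ ≫ φ₁)) := by
      rw [Functor.map_comp]; exact R.downward_closed h₁ _
    have h₄ : R (𝒳.p.map (ψ₂ ≫ φ₂)) := hψ ▸ h₃
    rw [← hc φ₁ ψ₁ h₁ h₃, ← hc φ₂ ψ₂ h₂ h₄]
    congr 2
  choose z φ t hφ ho ht using fun s => h𝒳.exists_lift_mem hR s
  have hd : ∀ {w : 𝒳.obj} (ψ : w ⟶ y) (hψ : R (𝒳.p.map ψ)) (s : 𝒳.p.obj w),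
      c (φ (𝒳.p.map ψ s)) (hφ _) (t _) = c ψ hψ s := fun ψ hψ s =>
    key _ _ _ _ _ _ (ht _)
  refine ⟨⟨fun s => c (φ s) (hφ s) (t s), ?_⟩, fun ψ hψ s => hd ψ hψ s⟩
  -- The chosen lift `φ s` is open over the base, so it carries a neighbourhood on which the local
  -- function is constant to a neighbourhood of `s`.
  rw [IsLocallyConstant.iff_exists_open]
  intro s
  obtain ⟨U, hU, hsU, hU'⟩ := (IsLocallyConstant.iff_exists_open _).1
    (c (φ s) (hφ s)).isLocallyConstant (t s)
  refine ⟨𝒳.p.map (φ s) '' U, ho s U hU, ⟨_, hsU, ht s⟩, ?_⟩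
  rintro _ ⟨r, hr, rfl⟩
  exact (hd (φ s) (hφ s) r).trans (hU' r hr)

end EtaleLocally

/-! ### Log structures at geometric points -/

namespace FsLogCFG

section Point

variable (X : FsLogCFG.{u})

/-- The restriction homomorphism of the sheaf of monoids along a morphism. -/
def res {x y : X.toCat.obj} (φ : y ⟶ x) : X.M.obj (op x) →* X.M.obj (op y) :=
  (X.M.map φ.op).hom

theorem res_id (x : X.toCat.obj) (m : X.M.obj (op x)) : X.res (𝟙 x) m = m := by
  simp [res]

theorem res_comp {x y z : X.toCat.obj} (φ : y ⟶ x) (ψ : z ⟶ y) (m : X.M.obj (op x)) :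
    X.res (ψ ≫ φ) m = X.res ψ (X.res φ m) := by
  simp [res]

theorem α_res {x y : X.toCat.obj} (φ : y ⟶ x) (m : X.M.obj (op x)) :
    X.α y (X.res φ m) = (X.toCat.p.map φ).appTop (X.α x m) :=
  X.α_map φ m

theorem res_res_inv {x y : X.toCat.obj} (e : y ≅ x) (m : X.M.obj (op y)) :
    X.res e.hom (X.res e.inv m) = m := by
  rw [← res_comp, e.hom_inv_id, res_id]

variable {X}

/-- The inverse of `α m` lifts to some `n`, and uniqueness of the lift of `1` forces `m * n = 1`. -/
theorem isUnit_α_iff {x : X.toCat.obj} {m : X.M.obj (op x)} : IsUnit (X.α x m) ↔ IsUnit m := by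
  refine ⟨fun ⟨v, hv⟩ => ?_, fun h => h.map _⟩
  obtain ⟨n, hn, -⟩ := X.isLog x v⁻¹
  refine IsUnit.of_mul_eq_one n ((X.isLog x 1).unique ?_ ?_)
  · rw [map_mul, hn, ← hv]; simp
  · simp

theorem eq_of_etaleLocally {x : X.toCat.obj} {m n : X.M.obj (op x)}
    (h : EtaleLocally X.toCat x fun _ φ => X.res φ m = X.res φ n) : m = n := by
  obtain ⟨R, hR, h⟩ := h
  exact (X.isSheaf x R hR).isSeparatedFor.ext fun y φ hφ => h y φ hφ

theorem IsGeometricPoint.etaleLocally {x : X.toCat.obj} (hx : X.IsGeometricPoint x)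
    {A : ∀ y : X.toCat.obj, (y ⟶ x) → Prop} (hA : EtaleLocally X.toCat x A) : A x (𝟙 x) := by
  obtain ⟨K, _, _, ⟨e⟩⟩ := hx
  exact hA.id_of_iso e

theorem IsGeometricPoint.nonempty {x : X.toCat.obj} (hx : X.IsGeometricPoint x) :
    Nonempty (X.toCat.p.obj x) := by
  obtain ⟨K, _, _, ⟨e⟩⟩ := hx
  exact ⟨e.inv (Classical.arbitrary (PrimeSpectrum K))⟩

/-- Over the empty scheme the ring of functions is zero, so every section is the unique lift of the
unit `1`. -/
theorem subsingleton_of_isEmpty {x : X.toCat.obj} [IsEmpty (X.toCat.p.obj x)] :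
    Subsingleton (X.M.obj (op x)) := by
  refine ⟨fun m n => (X.isLog x 1).unique ?_ ?_⟩ <;> exact Subsingleton.elim _ _

/-- The functions at a geometric point form a field: a non-unit has `α m = 0`, and `0` is not a unit
on any nonempty scheme over the point. -/
theorem IsGeometricPoint.isUnit_of_res {x : X.toCat.obj} (hx : X.IsGeometricPoint x)
    {y : X.toCat.obj} [Nonempty (X.toCat.p.obj y)] (φ : y ⟶ x) {m : X.M.obj (op x)}
    (h : IsUnit (X.res φ m)) : IsUnit m := by
  obtain ⟨K, _, _, ⟨e⟩⟩ := hx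
  let E : Γ(X.toCat.p.obj x, ⊤) ≅ CommRingCat.of K :=
    (Scheme.Γ.mapIso e.op).symm ≪≫ Scheme.ΓSpecIso (CommRingCat.of K)
  rw [← isUnit_α_iff, ← isUnit_map_iff E.commRingCatIsoToRingEquiv, isUnit_iff_ne_zero]
  intro h0
  rw [EmbeddingLike.map_eq_zero_iff] at h0
  have h1 := isUnit_α_iff.2 h
  rw [α_res, h0, map_zero] at h1
  have : Nonempty (⊤ : (X.toCat.p.obj y).Opens) := ⟨⟨Classical.arbitrary _, trivial⟩⟩
  exact not_isUnit_zero h1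

/-- At a geometric point the log structure has a chart by an fs monoid. -/
theorem IsGeometricPoint.exists_chart {x : X.toCat.obj} (hx : X.IsGeometricPoint x) :
    ∃ (P : Type u) (_ : CommMonoid P) (c : P →* X.M.obj (op x)),
      IsFsMonoid P ∧ IsChart X.M c :=
  hx.etaleLocally (X.isFs x)

end Point

end FsLogCFG

/-! ### Charts at geometric points -/

namespace IsChart

open FsLogCFG

variable {X : FsLogCFG.{u}} {x : X.toCat.obj} {P : Type u} [CommMonoid P]
  {c : P →* X.M.obj (op x)}

theorem exists_eq_mul (hc : IsChart X.M c) (hx : X.IsGeometricPoint x) (m : X.M.obj (op x)) :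
    ∃ (a : P) (v : (X.M.obj (op x))ˣ), m = c a * v := by
  obtain ⟨a, v, h⟩ := hx.etaleLocally (hc.surj (𝟙 x) m)
  refine ⟨a, v, ?_⟩
  simpa using h

/-- The relation `a * r = b * s` lives in `P`; only the invertibility of `c r` and `c s` must
descend from an étale neighbourhood, which it does by `isUnit_of_res`. -/
theorem exists_eq_of_res (hc : IsChart X.M c) (hx : X.IsGeometricPoint x) {y : X.toCat.obj}
    [hy : Nonempty (X.toCat.p.obj y)] (φ : y ⟶ x) {a b : P} {v w : (X.M.obj (op y))ˣ}
    (h : X.res φ (c a) * v = X.res φ (c b) * w) :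
    ∃ r s : P, IsUnit (c r) ∧ IsUnit (c s) ∧ a * r = b * s := by
  obtain ⟨z, ψ, t, ⟨r, s, hr, hs, hrs, -⟩, -, -⟩ :=
    (hc.inj φ a b v w h).exists_of_mem X.isFiberedInGroupoids hy.some
  have : Nonempty (X.toCat.p.obj z) := ⟨t⟩
  exact ⟨r, s, hx.isUnit_of_res _ hr, hx.isUnit_of_res _ hs, hrs⟩

/-- Units act freely: with equal chart elements, `inj` gives `r = s` by cancellation in `P`, and
then `v = w` étale locally. -/
theorem eq_of_res (hc : IsChart X.M c) [IsCancelMul P] {y : X.toCat.obj} (φ : y ⟶ x) {a : P}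
    {v w : (X.M.obj (op y))ˣ} (h : X.res φ (c a) * v = X.res φ (c a) * w) : v = w := by
  refine Units.ext (eq_of_etaleLocally ((hc.inj φ a a v w h).mono fun z ψ => ?_))
  rintro ⟨r, s, hr, hs, hrs, h'⟩
  obtain rfl := mul_left_cancel hrs
  exact hr.mul_right_cancel h'

end IsChart

/-! ### Monoids and ghost stalks at geometric points -/

namespace FsLogCFG

variable {X : FsLogCFG.{u}} {x : X.toCat.obj}

namespace IsGeometricPoint

/-- Cancelling in the chart monoid shows that `c b` is `c a` times a unit; that the remaining units
match is the freeness of their action. -/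
theorem isCancelMul (hx : X.IsGeometricPoint x) : IsCancelMul (X.M.obj (op x)) := by
  obtain ⟨P, _, c, hP, hc⟩ := hx.exists_chart
  have := hP.integral
  have := hx.nonempty
  have key : ∀ m n e : X.M.obj (op x), e * m = e * n → m = n := by
    intro m n e h
    obtain ⟨a, v, rfl⟩ := hc.exists_eq_mul hx m
    obtain ⟨b, w, rfl⟩ := hc.exists_eq_mul hx n
    obtain ⟨d, t, rfl⟩ := hc.exists_eq_mul hx e
    have h1 : c (d * a) * (t * v : (X.M.obj (op x))ˣ) =
        c (d * b) * (t * w : (X.M.obj (op x))ˣ) := by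
      rw [map_mul, map_mul, Units.val_mul, Units.val_mul, mul_mul_mul_comm, h, mul_mul_mul_comm]
    obtain ⟨r, s, hr, hs, hrs⟩ := hc.exists_eq_of_res hx (𝟙 x) (a := d * a) (b := d * b)
      (by rwa [res_id, res_id])
    rw [mul_assoc, mul_assoc] at hrs
    have h2 := congrArg c (mul_left_cancel hrs)
    rw [map_mul, map_mul] at h2
    obtain ⟨r', hr'⟩ := hr
    obtain ⟨s', hs'⟩ := hs
    have hb : c b = c a * (r' * s'⁻¹ : (X.M.obj (op x))ˣ) := by
      rw [Units.val_mul, ← mul_assoc, hr', h2, ← hs', Units.mul_inv_cancel_right]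
    rw [map_mul, map_mul, hb, ← mul_assoc (c d), ← map_mul, mul_assoc, ← Units.val_mul] at h1
    have h3 : t * v = r' * s'⁻¹ * (t * w) :=
      hc.eq_of_res (𝟙 x) (a := d * a) (by rw [res_id]; exact h1)
    have h4 : v = r' * s'⁻¹ * w := by
      rw [mul_left_comm] at h3
      exact mul_left_cancel h3
    rw [h4, hb, Units.val_mul, mul_assoc]
  exact
    { mul_left_cancel := fun e m n h => key m n e h
      mul_right_cancel := fun e m n h => key m n e (by simpa [mul_comm] using h) }

/-- Together with `exists_eq_res_mul`, this says that over a geometric point the ghost sheaf is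
constant with value the ghost stalk. -/
theorem mk_eq_of_res (hx : X.IsGeometricPoint x) {y : X.toCat.obj}
    [Nonempty (X.toCat.p.obj y)] (φ : y ⟶ x) {k l : X.M.obj (op x)} {v w : (X.M.obj (op y))ˣ}
    (h : X.res φ k * v = X.res φ l * w) : Associates.mk k = Associates.mk l := by
  obtain ⟨P, _, c, hP, hc⟩ := hx.exists_chart
  obtain ⟨a, t, rfl⟩ := hc.exists_eq_mul hx k
  obtain ⟨b, t', rfl⟩ := hc.exists_eq_mul hx l
  obtain ⟨r, s, hr, hs, hrs⟩ := hc.exists_eq_of_res hx φ (a := a) (b := b)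
    (v := Units.map (X.res φ) t * v) (w := Units.map (X.res φ) t' * w) (by
      simpa [mul_assoc] using h)
  have h1 := congrArg (fun m => Associates.mk (c m)) hrs
  simp only [map_mul, ← Associates.mk_mul_mk] at h1
  rw [Associates.mk_eq_one.2 hr, Associates.mk_eq_one.2 hs, mul_one, mul_one] at h1
  rw [← Associates.mk_mul_mk, ← Associates.mk_mul_mk, h1, Associates.mk_eq_one.2 t.isUnit,
    Associates.mk_eq_one.2 t'.isUnit]

theorem eq_of_res_mul (hx : X.IsGeometricPoint x) {y : X.toCat.obj} (φ : y ⟶ x)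
    {k : X.M.obj (op x)} {v w : (X.M.obj (op y))ˣ} (h : X.res φ k * v = X.res φ k * w) :
    v = w := by
  obtain ⟨P, _, c, hP, hc⟩ := hx.exists_chart
  have := hP.integral
  obtain ⟨a, t, rfl⟩ := hc.exists_eq_mul hx k
  refine mul_left_cancel (hc.eq_of_res φ (a := a) (v := Units.map (X.res φ) t * v)
    (w := Units.map (X.res φ) t * w) ?_)
  simpa [mul_assoc] using h

theorem exists_eq_res_mul (hx : X.IsGeometricPoint x) {y : X.toCat.obj} (φ : y ⟶ x)
    (m : X.M.obj (op y)) : EtaleLocally X.toCat y fun z ψ =>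
      ∃ (k : X.M.obj (op x)) (v : (X.M.obj (op z))ˣ), X.res ψ m = X.res (ψ ≫ φ) k * v := by
  obtain ⟨P, _, c, hP, hc⟩ := hx.exists_chart
  refine (hc.surj φ m).mono fun z ψ => ?_
  rintro ⟨a, v, h⟩
  exact ⟨c a, v, h⟩

/-- The ghost stalk at a geometric point is an fs monoid. -/
theorem isFsMonoid_ghost (hx : X.IsGeometricPoint x) : IsFsMonoid (X.Ghost x) := by
  obtain ⟨P, _, c, hP, hc⟩ := hx.exists_chart
  have := hP.integral
  have := hP.fg
  have := hx.nonempty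
  have := hx.isCancelMul
  let π : P →* X.Ghost x := Associates.mkMonoidHom.comp c
  have hπ : Function.Surjective π := by
    intro g
    obtain ⟨m, rfl⟩ := Associates.mk_surjective g
    obtain ⟨a, v, rfl⟩ := hc.exists_eq_mul hx m
    refine ⟨a, ?_⟩
    rw [← Associates.mk_mul_mk, Associates.mk_eq_one.2 v.isUnit, mul_one]
    rfl
  have hπ' : ∀ a b, π a = π b → ∃ r s : P, π r = 1 ∧ π s = 1 ∧ a * r = b * s := by
    intro a b h
    obtain ⟨v, hv⟩ := Associates.mk_eq_mk_iff_associated.1 h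
    obtain ⟨r, s, hr, hs, hrs⟩ := hc.exists_eq_of_res hx (𝟙 x) (a := a) (b := b) (v := v) (w := 1)
      (by simpa [res_id] using hv)
    exact ⟨r, s, Associates.mk_eq_one.2 hr, Associates.mk_eq_one.2 hs, hrs⟩
  refine ⟨Monoid.fg_of_surjective π hπ, ?_, ?_⟩
  · have key : ∀ m n e : X.Ghost x, e * m = e * n → m = n := by
      intro m n e h
      obtain ⟨m, rfl⟩ := Associates.mk_surjective m
      obtain ⟨n, rfl⟩ := Associates.mk_surjective n
      obtain ⟨e, rfl⟩ := Associates.mk_surjective e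
      rw [Associates.mk_mul_mk, Associates.mk_mul_mk, Associates.mk_eq_mk_iff_associated] at h
      obtain ⟨v, hv⟩ := h
      rw [mul_assoc] at hv
      exact Associates.mk_eq_mk_iff_associated.2 ⟨v, mul_left_cancel hv⟩
    exact
      { mul_left_cancel := fun e m n h => key m n e h
        mul_right_cancel := fun e m n h => key m n e (by simpa [mul_comm] using h) }
  · rintro m n k hk ⟨e, he⟩
    obtain ⟨a, rfl⟩ := hπ m
    obtain ⟨b, rfl⟩ := hπ n
    obtain ⟨d, rfl⟩ := hπ e
    rw [← map_pow, ← map_pow, ← map_mul] at he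
    obtain ⟨r, s, hr, hs, hrs⟩ := hπ' _ _ he
    have h1 : a ^ k ∣ (b * r) ^ k := by
      refine ⟨d * s * r ^ (k - 1), ?_⟩
      rw [mul_pow, ← mul_assoc, ← mul_assoc, ← hrs, mul_assoc, mul_pow_sub_one hk.ne']
    have h2 := map_dvd π (hP.saturated _ _ k hk h1)
    rwa [map_mul, hr, mul_one] at h2

end IsGeometricPoint

end FsLogCFG

namespace FsLogCFG.IsGeometricPoint

variable {X : FsLogCFG.{u}} {x : X.toCat.obj} {D : Type} [CommMonoid D]

/-! ### Locally constant functions associated to homomorphisms on ghost stalks -/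

/-- Étale locally `m` is a unit times the pull-back of some `k`, whose ghost class is determined on
nonempty schemes; so the constants `u k` agree on overlaps and glue. -/
theorem exists_localValue (hx : X.IsGeometricPoint x) (u : X.Ghost x →* D) {y : X.toCat.obj}
    (φ : y ⟶ x) (m : X.M.obj (op y)) : ∃ c : LocallyConstant (X.toCat.p.obj y) D,
      ∀ (z : X.toCat.obj) (ψ : z ⟶ y) (k : X.M.obj (op x)) (v : (X.M.obj (op z))ˣ),
        X.res ψ m = X.res (ψ ≫ φ) k * v →
          ∀ s : X.toCat.p.obj z, c (X.toCat.p.map ψ s) = u (Associates.mk k) := by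
  have hX := X.isFiberedInGroupoids
  have key : ∀ (z : X.toCat.obj) (ψ : z ⟶ y) (k k' : X.M.obj (op x)) (v v' : (X.M.obj (op z))ˣ),
      X.res ψ m = X.res (ψ ≫ φ) k * v → X.res ψ m = X.res (ψ ≫ φ) k' * v' →
      ∀ _ : X.toCat.p.obj z, u (Associates.mk k) = u (Associates.mk k') := by
    intro z ψ k k' v v' h h' s
    have : Nonempty (X.toCat.p.obj z) := ⟨s⟩
    rw [hx.mk_eq_of_res (ψ ≫ φ) (h.symm.trans h')]
  have hres : ∀ {z w : X.toCat.obj} (ψ : z ⟶ y) (χ : w ⟶ z) (k : X.M.obj (op x))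
      (v : (X.M.obj (op z))ˣ), X.res ψ m = X.res (ψ ≫ φ) k * v →
      X.res (χ ≫ ψ) m = X.res ((χ ≫ ψ) ≫ φ) k * (Units.map (X.res χ) v) := by
    intro z w ψ χ k v h
    rw [res_comp, h, map_mul, ← res_comp, Category.assoc]
    rfl
  obtain ⟨R, hR, h⟩ := hx.exists_eq_res_mul φ m
  choose k v hkv using h
  obtain ⟨c, hc⟩ := hX.exists_locallyConstant hR
    (fun ψ hψ => LocallyConstant.const _ (u (Associates.mk (k _ ψ hψ))))
    (fun ψ χ hψ hψχ s => key _ _ _ _ _ _ (hkv _ _ hψχ) (hres _ χ _ _ (hkv _ _ hψ)) s)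
  refine ⟨c, fun z ψ k' v' h' s => ?_⟩
  obtain ⟨w, χ, t, hχ, -, ht⟩ := hX.exists_lift_mem hR (X.toCat.p.map ψ s)
  obtain ⟨w', χ₁, χ₂, s', hχ', rfl, rfl⟩ := hX.exists_common_refinement χ ψ t s ht
  rw [← ht, hc χ hχ]
  exact key w' (χ₁ ≫ χ) _ _ _ (Units.map (X.res χ₂) v') (hres _ χ₁ _ _ (hkv _ _ hχ))
    (by rw [hχ']; exact hres ψ χ₂ k' v' h') s'

/-- The locally constant function associated to a section `m` of the sheaf of monoids over
`φ : y → x` and a homomorphism `u` on the ghost stalk at the geometric point `x`: its value is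
`u k` wherever `m` differs from the pull-back of `k` by a unit. -/
def localValueFun (hx : X.IsGeometricPoint x) (u : X.Ghost x →* D) {y : X.toCat.obj}
    (φ : y ⟶ x) (m : X.M.obj (op y)) : LocallyConstant (X.toCat.p.obj y) D :=
  (hx.exists_localValue u φ m).choose

theorem localValueFun_apply (hx : X.IsGeometricPoint x) (u : X.Ghost x →* D) {y z : X.toCat.obj}
    (φ : y ⟶ x) (m : X.M.obj (op y)) (ψ : z ⟶ y) (k : X.M.obj (op x)) (v : (X.M.obj (op z))ˣ)
    (h : X.res ψ m = X.res (ψ ≫ φ) k * v) (s : X.toCat.p.obj z) :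
    hx.localValueFun u φ m (X.toCat.p.map ψ s) = u (Associates.mk k) :=
  (hx.exists_localValue u φ m).choose_spec z ψ k v h s

theorem localValueFun_res (hx : X.IsGeometricPoint x) (u : X.Ghost x →* D) {y z : X.toCat.obj}
    (φ : y ⟶ x) (m : X.M.obj (op y)) (ψ : z ⟶ y) (s : X.toCat.p.obj z) :
    hx.localValueFun u (ψ ≫ φ) (X.res ψ m) s = hx.localValueFun u φ m (X.toCat.p.map ψ s) := by
  obtain ⟨w, χ, t, ⟨k, v, h⟩, -, rfl⟩ :=
    (hx.exists_eq_res_mul (ψ ≫ φ) (X.res ψ m)).exists_of_mem X.isFiberedInGroupoids s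
  rw [hx.localValueFun_apply u _ _ χ k v h, ← Scheme.Hom.comp_apply, ← Functor.map_comp,
    hx.localValueFun_apply u φ m (χ ≫ ψ) k v (by rw [res_comp, h, Category.assoc])]

/-- The homomorphism from the sections of the sheaf of monoids over `φ : y → x` to the locally
constant functions associated to a homomorphism on the ghost stalk at `x`. -/
def localValue (hx : X.IsGeometricPoint x) (u : X.Ghost x →* D) {y : X.toCat.obj}
    (φ : y ⟶ x) : X.M.obj (op y) →* LocallyConstant (X.toCat.p.obj y) D where
  toFun := hx.localValueFun u φ
  map_one' := by
    ext s
    have h := hx.localValueFun_apply u φ 1 (𝟙 y) 1 1 (by simp) s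
    simpa [Associates.mk_one] using h
  map_mul' m n := by
    ext s
    obtain ⟨z, ψ, t, ⟨⟨k, v, h⟩, ⟨l, w, h'⟩⟩, -, rfl⟩ :=
      ((hx.exists_eq_res_mul φ m).and (hx.exists_eq_res_mul φ n)).exists_of_mem
        X.isFiberedInGroupoids s
    rw [LocallyConstant.mul_apply, hx.localValueFun_apply u φ m ψ k v h,
      hx.localValueFun_apply u φ n ψ l w h',
      hx.localValueFun_apply u φ (m * n) ψ (k * l) (v * w) (by
        rw [map_mul, map_mul, h, h', Units.val_mul, mul_mul_mul_comm]),
      ← map_mul, Associates.mk_mul_mk]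

theorem localValue_apply (hx : X.IsGeometricPoint x) (u : X.Ghost x →* D) {y z : X.toCat.obj}
    (φ : y ⟶ x) (m : X.M.obj (op y)) (ψ : z ⟶ y) (k : X.M.obj (op x)) (v : (X.M.obj (op z))ˣ)
    (h : X.res ψ m = X.res (ψ ≫ φ) k * v) (s : X.toCat.p.obj z) :
    hx.localValue u φ m (X.toCat.p.map ψ s) = u (Associates.mk k) :=
  hx.localValueFun_apply u φ m ψ k v h s

theorem localValue_res (hx : X.IsGeometricPoint x) (u : X.Ghost x →* D) {y z : X.toCat.obj}
    (φ : y ⟶ x) (m : X.M.obj (op y)) (ψ : z ⟶ y) (s : X.toCat.p.obj z) :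
    hx.localValue u (ψ ≫ φ) (X.res ψ m) s = hx.localValue u φ m (X.toCat.p.map ψ s) :=
  hx.localValueFun_res u φ m ψ s

theorem localValue_id (hx : X.IsGeometricPoint x) (u : X.Ghost x →* D) (m : X.M.obj (op x))
    (s : X.toCat.p.obj x) : hx.localValue u (𝟙 x) m s = u (Associates.mk m) := by
  have h := hx.localValue_apply u (𝟙 x) m (𝟙 x) m 1 (by simp) s
  simpa using h

end FsLogCFG.IsGeometricPoint

/-! ### Slices of categories fibred in groupoids -/

/-- The category of objects over `z` of a category over schemes. -/
def overCat (𝒳 : BasedCategory.{u, u + 1} Scheme.{u}) (z : 𝒳.obj) :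
    BasedCategory.{u, u + 1} Scheme.{u} :=
  BasedCategory.ofFunctor (Over.forget z ⋙ 𝒳.p)

/-- Lifts and factorizations are taken in `𝒳`; the compatibility with the structure morphisms to `z`
is then automatic. -/
theorem isFiberedInGroupoids_overCat {𝒳 : BasedCategory.{u, u + 1} Scheme.{u}}
    (h𝒳 : IsFiberedInGroupoids 𝒳) (z : 𝒳.obj) : IsFiberedInGroupoids (overCat 𝒳 z) := by
  have key : ∀ {s t : Over z} (φ : s ⟶ t),
      (Over.forget z ⋙ 𝒳.p).IsStronglyCartesian (𝒳.p.map φ.left) φ := by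
    intro s t φ
    have h := h𝒳.isStronglyCartesian φ.left
    have hl : (Over.forget z ⋙ 𝒳.p).IsHomLift (𝒳.p.map φ.left) φ :=
      IsHomLift.map (Over.forget z ⋙ 𝒳.p) φ
    refine { toIsHomLift := hl, universal_property' := fun {r} g φ' hφ' => ?_ }
    have h1 : 𝒳.p.map φ'.left = g ≫ 𝒳.p.map φ.left := by
      exact (IsHomLift.fac' (Over.forget z ⋙ 𝒳.p) (g ≫ 𝒳.p.map φ.left) φ').trans
        ((Category.id_comp _).trans (Category.comp_id _))
    obtain ⟨χ, hχ, hχ'⟩ := h𝒳.exists_fac φ.left φ'.left g h1.symm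
    refine ⟨Over.homMk χ (by rw [← Over.w φ, ← Category.assoc, hχ, Over.w]), ⟨?_, ?_⟩, ?_⟩
    · have := IsHomLift.map (Over.forget z ⋙ 𝒳.p)
        (Over.homMk χ (by rw [← Over.w φ, ← Category.assoc, hχ, Over.w]) : r ⟶ s)
      change (Over.forget z ⋙ 𝒳.p).IsHomLift (𝒳.p.map χ) _ at this
      rwa [hχ'] at this
    · ext; exact hχ
    · rintro π ⟨hπ, hπ'⟩
      have h2 : 𝒳.p.map π.left = g := by
        exact (IsHomLift.fac' (Over.forget z ⋙ 𝒳.p) g π).trans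
          ((Category.id_comp _).trans (Category.comp_id _))
      have i1 : 𝒳.p.IsHomLift g π.left := by rw [← h2]; exact IsHomLift.map 𝒳.p _
      have i2 : 𝒳.p.IsHomLift g χ := by rw [← hχ']; exact IsHomLift.map 𝒳.p _
      refine Over.OverMorphism.ext (Functor.IsStronglyCartesian.ext 𝒳.p (𝒳.p.map φ.left) φ.left g
        (ψ := π.left) (ψ' := χ) ?_)
      rw [← Over.comp_left, hπ', hχ]
  refine ⟨Functor.IsFibered.of_exists_isStronglyCartesian fun t V f => ?_, fun φ => key φ⟩
  change V ⟶ 𝒳.p.obj t.left at f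
  have := h𝒳.isFibered
  obtain ⟨w, φ, hφ⟩ := IsPreFibered.exists_isCartesian 𝒳.p rfl f
  have h1 := IsHomLift.domain_eq 𝒳.p f φ
  subst h1
  have h2 : f = 𝒳.p.map φ := by
    have := IsHomLift.fac' 𝒳.p f φ
    simpa using this.symm
  subst h2
  exact ⟨Over.mk (φ ≫ t.hom), Over.homMk φ, key (Over.homMk φ : Over.mk (φ ≫ t.hom) ⟶ t)⟩

theorem etaleLocally_overCat_iff {𝒳 : BasedCategory.{u, u + 1} Scheme.{u}} {z : 𝒳.obj} {t : Over z}
    {A : ∀ s : (overCat 𝒳 z).obj, (s ⟶ t) → Prop} :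
    EtaleLocally (overCat 𝒳 z) t A ↔ EtaleLocally 𝒳 t.left fun y ψ =>
      A (Over.mk (ψ ≫ t.hom)) (Over.homMk ψ : Over.mk (ψ ≫ t.hom) ⟶ t) := by
  constructor
  · rintro ⟨R, hR, h⟩
    exact ⟨R, hR, fun y ψ hψ => h _ _ hψ⟩
  · rintro ⟨R, hR, h⟩
    refine ⟨R, hR, fun s φ hφ => ?_⟩
    have key : ∀ (y : 𝒳.obj) (ψ : y ⟶ t.left) (k : y ⟶ z) (e : k = ψ ≫ t.hom),
        R (𝒳.p.map ψ) → A (Over.mk k) (Over.homMk ψ e.symm : Over.mk k ⟶ t) := by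
      rintro y ψ _ rfl hψ
      exact h y ψ hψ
    exact key s.left φ.left s.hom (Over.w φ).symm hφ

theorem BasedFunctor.p_map {𝒳 𝒴 : BasedCategory.{u, u + 1} Scheme.{u}} (F : BasedFunctor 𝒳 𝒴)
    {x y : 𝒳.obj} (φ : x ⟶ y) : 𝒴.p.map (F.map φ) =
      eqToHom (F.w_obj x) ≫ 𝒳.p.map φ ≫ eqToHom (F.w_obj y).symm :=
  Functor.congr_hom F.w φ

/-- The schemes under `x` and `F x` are equal but not definitionally so; the covering sieve is
transported by pull-back along `eqToHom`. -/
theorem EtaleLocally.of_basedFunctor {𝒳 𝒴 : BasedCategory.{u, u + 1} Scheme.{u}}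
    (F : BasedFunctor 𝒳 𝒴) {x : 𝒳.obj} {A : ∀ y : 𝒴.obj, (y ⟶ F.obj x) → Prop}
    (h : EtaleLocally 𝒴 (F.obj x) A) :
    EtaleLocally 𝒳 x fun y φ => A (F.obj y) (F.map φ) := by
  obtain ⟨R, hR, h⟩ := h
  refine ⟨R.pullback (eqToHom (F.w_obj x).symm),
    GrothendieckTopology.pullback_stable _ _ hR, fun y φ hφ => h _ _ ?_⟩
  rw [BasedFunctor.p_map]
  exact R.downward_closed hφ _

/-- Pull-back of locally constant functions along a morphism of schemes. -/
def AlgebraicGeometry.Scheme.Hom.pullbackLocallyConstant {S S' : Scheme.{u}} (f : S ⟶ S')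
    (D : Type) [CommMonoid D] : LocallyConstant S' D →* LocallyConstant S D :=
  LocallyConstant.comapMonoidHom f.base.hom

theorem AlgebraicGeometry.Scheme.Hom.pullbackLocallyConstant_apply {S S' : Scheme.{u}} (f : S ⟶ S')
    {D : Type} [CommMonoid D] (c : LocallyConstant S' D) (s : S) :
    f.pullbackLocallyConstant D c s = c (f s) :=
  rfl

namespace FsLogCFG

variable (Z : FsLogCFG.{u}) {z : Z.toCat.obj} {D : Type} [CommMonoid D]

/-! ### Enlarging the log structure of a geometric point -/

/-- For a submonoid `L` of `Ghost z × D`, the pairs of a section `m` of the sheaf of monoids over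
`t → z` and a locally constant function `c` that étale locally are the product of the pull-back of
a pair `(k, d)` in the preimage of `L` and a unit. -/
def ghostSections (L : Submonoid (Z.Ghost z × D)) (t : Over z) :
    Submonoid (Z.M.obj (op t.left) × LocallyConstant (Z.toCat.p.obj t.left) D) where
  carrier := {a | EtaleLocally Z.toCat t.left fun y ψ =>
    ∃ (k : Z.M.obj (op z)) (d : D) (v : (Z.M.obj (op y))ˣ), (Associates.mk k, d) ∈ L ∧
      Z.res ψ a.1 = Z.res (ψ ≫ t.hom) k * v ∧ ∀ s, a.2 (Z.toCat.p.map ψ s) = d}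
  one_mem' := .of_forall fun y ψ => ⟨1, 1, 1, one_mem L, by simp, fun s => rfl⟩
  mul_mem' := by
    intro a b ha hb
    refine (ha.and hb).mono fun y ψ => ?_
    rintro ⟨⟨k, d, v, hk, hv, hd⟩, ⟨k', d', v', hk', hv', hd'⟩⟩
    refine ⟨k * k', d * d', v * v', mul_mem hk hk', ?_, fun s => ?_⟩
    · rw [Prod.fst_mul, map_mul, map_mul, hv, hv', Units.val_mul, mul_mul_mul_comm]
    · rw [Prod.snd_mul, LocallyConstant.mul_apply, hd, hd']

variable {Z}

theorem ghostSections_of_const {L : Submonoid (Z.Ghost z × D)} {t : Over z} {k : Z.M.obj (op z)}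
    {d : D} (h : (Associates.mk k, d) ∈ L) (v : (Z.M.obj (op t.left))ˣ) :
    (Z.res t.hom k * v, LocallyConstant.const _ d) ∈ Z.ghostSections L t :=
  .of_forall fun y ψ => ⟨k, d, Units.map (Z.res ψ) v, h, by
    simp [res_comp], fun s => rfl⟩

/-- The restriction of pairs of a section and a locally constant function. -/
def ghostSectionsMap (L : Submonoid (Z.Ghost z × D)) {s t : Over z} (φ : s ⟶ t) :
    Z.ghostSections L t →* Z.ghostSections L s :=
  (((Z.res φ.left).prodMap ((Z.toCat.p.map φ.left).pullbackLocallyConstant D)).comp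
    (Z.ghostSections L t).subtype).codRestrict _ fun a => (a.2.restrict φ.left).mono (by
      rintro y ψ ⟨k, d, v, hk, hv, hd⟩
      refine ⟨k, d, v, hk, ?_, fun r => ?_⟩
      · rw [res_comp, Category.assoc, Over.w] at hv
        exact hv
      · rw [← hd r, Functor.map_comp]
        rfl)

theorem ghostSections_ext {L : Submonoid (Z.Ghost z × D)} {t : Over z}
    {a b : Z.ghostSections L t} (h : a.1.1 = b.1.1) (h' : ∀ r, a.1.2 r = b.1.2 r) : a = b :=
  Subtype.ext (Prod.ext h (LocallyConstant.ext h'))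

/-- The second component of an element whose first component is a unit is trivial. -/
theorem IsGeometricPoint.snd_eq_one (hz : Z.IsGeometricPoint z) {L : Submonoid (Z.Ghost z × D)}
    (hL : ∀ d, (1, d) ∈ L → d = 1) {t : Over z} {a : Z.ghostSections L t} (h : IsUnit a.1.1)
    (r : Z.toCat.p.obj t.left) : a.1.2 r = 1 := by
  obtain ⟨y, ψ, s, ⟨k, d, v, hk, hv, hd⟩, -, rfl⟩ := a.2.exists_of_mem Z.isFiberedInGroupoids r
  have : Nonempty (Z.toCat.p.obj y) := ⟨s⟩
  have h1 : IsUnit (Z.res (ψ ≫ t.hom) k) := by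
    have h2 := h.map (Z.res ψ)
    rw [hv] at h2
    exact (Units.isUnit_mul_units _ v).1 h2
  rw [Associates.mk_eq_one.2 (hz.isUnit_of_res _ h1)] at hk
  rw [hd, hL d hk]

/-- The unit with trivial second component. -/
def ghostSectionsUnit (L : Submonoid (Z.Ghost z × D)) (t : Over z) :
    (Z.M.obj (op t.left))ˣ →* (Z.ghostSections L t)ˣ :=
  MonoidHom.toHomUnits
    { toFun := fun v => ⟨(v, 1), by
        have := ghostSections_of_const (L := L) (t := t) (k := 1) (d := 1) (one_mem L) v
        rwa [map_one, one_mul] at this⟩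
      map_one' := rfl
      map_mul' := fun v w => Subtype.ext (Prod.ext rfl (mul_one 1).symm) }

variable (Z) in
/-- The presheaf of pairs. -/
def ghostPresheaf (L : Submonoid (Z.Ghost z × D)) : (Over z)ᵒᵖ ⥤ CommMonCat.{u} where
  obj t := CommMonCat.of (Z.ghostSections L t.unop)
  map φ := CommMonCat.ofHom (ghostSectionsMap L φ.unop)
  map_id t := CommMonCat.hom_ext (MonoidHom.ext fun a => by
    refine ghostSections_ext (Z.res_id _ _) fun r => ?_
    change a.1.2 (Z.toCat.p.map (𝟙 _) r) = a.1.2 r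
    rw [CategoryTheory.Functor.map_id]
    rfl)
  map_comp φ ψ := CommMonCat.hom_ext (MonoidHom.ext fun a => by
    refine ghostSections_ext (Z.res_comp _ _ _) fun r => ?_
    change a.1.2 (Z.toCat.p.map (ψ.unop.left ≫ φ.unop.left) r) = _
    rw [Functor.map_comp]
    rfl)

/-- Sections of `M` glue, locally constant functions glue, and the condition imposed by `L` is étale
local. -/
theorem isSheafFor_ghostPresheaf (L : Submonoid (Z.Ghost z × D)) (t : Over z)
    {R : Sieve (Z.toCat.p.obj t.left)} (hR : R ∈ Scheme.etaleTopology (Z.toCat.p.obj t.left)) :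
    Presieve.IsSheafFor (Z.ghostPresheaf L ⋙ forget CommMonCat)
      (Sieve.functorPullback (X := t) (Over.forget z ⋙ Z.toCat.p) R).arrows := by
  intro x hx
  rw [Presieve.compatible_iff_sieveCompatible] at hx
  let x' : ∀ {y : Z.toCat.obj} (φ : y ⟶ t.left), R (Z.toCat.p.map φ) →
      Z.ghostSections L (Over.mk (φ ≫ t.hom)) := fun φ hφ =>
    x (Over.homMk φ : Over.mk (φ ≫ t.hom) ⟶ t) hφ
  have hx' : ∀ {s : Over z} (φ : s ⟶ t) (hφ : R (Z.toCat.p.map φ.left)),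
      (x φ hφ).1 = (x' φ.left hφ).1 := by
    intro s φ hφ
    have key : ∀ (y : Z.toCat.obj) (ψ : y ⟶ t.left) (k : y ⟶ z) (e : k = ψ ≫ t.hom)
        (hψ : R (Z.toCat.p.map ψ)),
        (x (Over.homMk ψ e.symm : Over.mk k ⟶ t) hψ).1 = (x' ψ hψ).1 := by
      rintro y ψ _ rfl hψ
      rfl
    exact key s.left φ.left s.hom (Over.w φ).symm hφ
  have hcomp : ∀ {y w : Z.toCat.obj} (φ : y ⟶ t.left) (ψ : w ⟶ y) (hφ : R (Z.toCat.p.map φ))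
      (hψ : R (Z.toCat.p.map (ψ ≫ φ))), (x' (ψ ≫ φ) hψ).1 =
        (ghostSectionsMap L (Over.homMk ψ : Over.mk (ψ ≫ φ ≫ t.hom) ⟶ Over.mk (φ ≫ t.hom))
          (x' φ hφ)).1 := by
    intro y w φ ψ hφ hψ
    exact (hx' _ _).symm.trans (congrArg Subtype.val (hx
      (Over.homMk φ : Over.mk (φ ≫ t.hom) ⟶ t)
      (Over.homMk ψ : Over.mk (ψ ≫ φ ≫ t.hom) ⟶ Over.mk (φ ≫ t.hom)) hφ))
  obtain ⟨m, hm, -⟩ := Z.isSheaf t.left R hR (fun y φ hφ => (x' φ hφ).1.1) (by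
    refine (Presieve.compatible_iff_sieveCompatible (S := R.functorPullback Z.toCat.p) _).2 ?_
    intro y w φ ψ hφ
    exact congrArg Prod.fst (hcomp φ ψ hφ _))
  obtain ⟨c, hc⟩ := Z.isFiberedInGroupoids.exists_locallyConstant hR
    (fun φ hφ => (x' φ hφ).1.2) (fun φ ψ hφ hψ s => by
      rw [hcomp φ ψ hφ hψ]
      rfl)
  have hmem : (m, c) ∈ Z.ghostSections L t := by
    refine EtaleLocally.bind Z.isFiberedInGroupoids hR fun y φ hφ => ?_
    refine EtaleLocally.mono (x' φ hφ).2 fun w ψ => ?_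
    rintro ⟨k, d, v, hk, hv, hd⟩
    refine ⟨k, d, v, hk, ?_, fun s => ?_⟩
    · rw [res_comp, Category.assoc]
      rw [← show _ = (x' φ hφ).1.1 from hm φ hφ] at hv
      exact hv
    · rw [← hd, ← hc φ hφ, Functor.map_comp]
      rfl
  refine ⟨⟨(m, c), hmem⟩, fun s φ hφ => ?_, fun b hb => ?_⟩
  · exact ghostSections_ext ((hm φ.left hφ).trans (congrArg Prod.fst (hx' φ hφ)).symm)
      fun r => (hc φ.left hφ r).trans (congrArg (fun a => a.2 r) (hx' φ hφ)).symm
  · have hb' : ∀ {y : Z.toCat.obj} (φ : y ⟶ t.left) (hφ : R (Z.toCat.p.map φ)),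
        ghostSectionsMap L (Over.homMk φ : Over.mk (φ ≫ t.hom) ⟶ t) b = x' φ hφ :=
      fun φ hφ => hb (Over.homMk φ : Over.mk (φ ≫ t.hom) ⟶ t) hφ
    refine ghostSections_ext (eq_of_etaleLocally ⟨R, hR, fun y φ hφ => ?_⟩) fun r => ?_
    · exact (congrArg (fun a => a.1.1) (hb' φ hφ)).trans (hm φ hφ).symm
    · obtain ⟨y, φ, s, hφ, -, rfl⟩ := Z.isFiberedInGroupoids.exists_lift_mem hR r
      exact (congrArg (fun a => a.1.2 s) (hb' φ hφ)).trans (hc φ hφ s).symm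

end FsLogCFG

/-! ### The chart of the enlargement and its log scheme -/

namespace FsLogCFG

variable {Z : FsLogCFG.{u}} {z : Z.toCat.obj} {D : Type} [CommMonoid D]

/-- The homomorphism from `L` to the presheaf of pairs given by a section of the quotient map to
the ghost stalk. -/
def ghostChart (L : Submonoid (Z.Ghost z × D)) (σ : Z.Ghost z →* Z.M.obj (op z))
    (hσ : ∀ r, Associates.mk (σ r) = r) (t : Over z) : L →* Z.ghostSections L t where
  toFun a := ⟨(Z.res t.hom (σ a.1.1), LocallyConstant.const _ a.1.2), by
    have := ghostSections_of_const (L := L) (t := t) (k := σ a.1.1) (d := a.1.2)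
      (by rw [hσ]; exact a.2) 1
    rwa [Units.val_one, mul_one] at this⟩
  map_one' := ghostSections_ext (by simp) fun r => rfl
  map_mul' a b := ghostSections_ext (by simp) fun r => rfl

theorem ghostSectionsMap_ghostChart (L : Submonoid (Z.Ghost z × D))
    (σ : Z.Ghost z →* Z.M.obj (op z)) (hσ : ∀ r, Associates.mk (σ r) = r) {s t : Over z}
    (φ : s ⟶ t) (a : L) :
    ghostSectionsMap L φ (ghostChart L σ hσ t a) = ghostChart L σ hσ s a := by
  refine ghostSections_ext ?_ fun r => rfl
  change Z.res φ.left (Z.res t.hom _) = Z.res s.hom _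
  rw [← res_comp, Over.w]

/-- Surjectivity holds because `k` and `σ` of its class differ by a unit. For injectivity, `hL`
makes the function component of any unit trivial, so two chart elements differing by a unit have the
same class in the ghost stalk and the same component in `D`. -/
theorem isChart_ghostChart (hz : Z.IsGeometricPoint z) (L : Submonoid (Z.Ghost z × D))
    (hL : ∀ d, (1, d) ∈ L → d = 1) (σ : Z.Ghost z →* Z.M.obj (op z))
    (hσ : ∀ r, Associates.mk (σ r) = r) (t : Over z) :
    IsChart (𝒳 := overCat Z.toCat z) (Z.ghostPresheaf L) (x := t) (ghostChart L σ hσ t) where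
  surj := by
    intro s φ a
    refine etaleLocally_overCat_iff.2 (EtaleLocally.mono a.2 fun y ψ => ?_)
    rintro ⟨k, d, v, hk, hv, hd⟩
    have hσk : Associates.mk (σ (Associates.mk k)) = Associates.mk k := hσ _
    obtain ⟨g, hg⟩ := Associates.mk_eq_mk_iff_associated.1 hσk
    let w : (Z.M.obj (op y))ˣ := Units.map (Z.res (ψ ≫ s.hom)) g * v
    refine ⟨⟨(Associates.mk k, d), hk⟩, ghostSectionsUnit L (Over.mk (ψ ≫ s.hom)) w, ?_⟩
    refine Eq.trans (ghostSections_ext ?_ fun r => ?_)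
      (congrArg (· * (ghostSectionsUnit L (Over.mk (ψ ≫ s.hom)) w).val)
        (ghostSectionsMap_ghostChart L σ hσ ((Over.homMk ψ : Over.mk (ψ ≫ s.hom) ⟶ s) ≫ φ)
          ⟨(Associates.mk k, d), hk⟩).symm)
    · have key : ∀ ρ : Z.M.obj (op z) →* Z.M.obj (op y),
          ρ k * v = ρ (σ (Associates.mk k)) * (ρ g * v) := fun ρ => by
        rw [← mul_assoc, ← map_mul, hg]
      exact hv.trans (key (Z.res (ψ ≫ s.hom)))
    · exact (hd r).trans (mul_one d).symm
  inj := by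
    intro s φ a b v w h
    replace h := ((congrArg (· * v.val) (ghostSectionsMap_ghostChart L σ hσ φ a)).symm.trans h).trans
      (congrArg (· * w.val) (ghostSectionsMap_ghostChart L σ hσ φ b))
    rcases isEmpty_or_nonempty (Z.toCat.p.obj s.left) with hs | hs
    -- Over the empty scheme all sections are trivial, and `a * b = b * a` supplies the relation.
    · refine .of_forall fun r ψ => ?_
      have : IsEmpty (Z.toCat.p.obj r.left) := ⟨fun q => hs.false (Z.toCat.p.map ψ.left q)⟩
      have h1 : Subsingleton (Z.M.obj (op r.left)) := subsingleton_of_isEmpty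
      have h2 : Subsingleton (Z.ghostSections L r) :=
        ⟨fun p q => ghostSections_ext (Subsingleton.elim _ _) fun q' => isEmptyElim q'⟩
      have h3 : ∀ q : Z.ghostSections L r, IsUnit q := fun q => by
        rw [Subsingleton.elim q 1]; exact isUnit_one
      exact ⟨b, a, h3 _, h3 _, mul_comm _ _, h2.elim _ _⟩
    · have hv1 : IsUnit (v.val.1.1) := v.isUnit.map
        ((MonoidHom.fst _ _).comp (Z.ghostSections L s).subtype)
      have hw1 : IsUnit (w.val.1.1) := w.isUnit.map
        ((MonoidHom.fst _ _).comp (Z.ghostSections L s).subtype)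
      have h1 : Z.res s.hom (σ a.1.1) * hv1.unit = Z.res s.hom (σ b.1.1) * hw1.unit :=
        congrArg (fun c => c.1.1) h
      have h2 : a.1.1 = b.1.1 := by
        rw [← hσ a.1.1, hz.mk_eq_of_res _ h1, hσ]
      have h3 : a.1.2 = b.1.2 := by
        obtain ⟨q⟩ := hs
        have h4 : a.1.2 * v.val.1.2 q = b.1.2 * w.val.1.2 q := congrArg (fun c => c.1.2 q) h
        rwa [hz.snd_eq_one hL hv1, hz.snd_eq_one hL hw1, mul_one, mul_one] at h4
      obtain rfl : a = b := Subtype.ext (Prod.ext h2 h3)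
      have h5 : v = w := by
        refine Units.ext (ghostSections_ext ?_ fun q => ?_)
        · exact congrArg Units.val (hz.eq_of_res_mul _ h1)
        · rw [hz.snd_eq_one hL hv1, hz.snd_eq_one hL hw1]
      subst h5
      have h6 : ∀ {r : Over z} (χ : r ⟶ t), IsUnit (ghostSectionsMap L χ (ghostChart L σ hσ t 1)) :=
        fun χ => isUnit_one.map ((ghostSectionsMap L χ).comp (ghostChart L σ hσ t))
      exact .of_forall fun r ψ => ⟨1, 1, h6 (ψ ≫ φ), h6 (ψ ≫ φ), rfl, rfl⟩

/-- The log scheme with the same underlying scheme as the geometric point `z` and with the log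
structure given by pairs of a section of the log structure of `Z` and a locally constant function
to `D`, that are subject to the condition given by a submonoid `L` of `Ghost z × D`. -/
def ofGhostSubmonoid (hz : Z.IsGeometricPoint z) (L : Submonoid (Z.Ghost z × D))
    (hL : ∀ d, (1, d) ∈ L → d = 1) (hfs : IsFsMonoid L) : FsLogCFG.{u} where
  toCat := overCat Z.toCat z
  isFiberedInGroupoids := isFiberedInGroupoids_overCat Z.isFiberedInGroupoids z
  M := Z.ghostPresheaf L
  α t := (Z.α t.left).comp ((MonoidHom.fst _ _).comp (Z.ghostSections L t).subtype)
  α_map φ a := Z.α_map φ.left a.1.1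
  isSheaf t _ hR := isSheafFor_ghostPresheaf L t hR
  isLog t v := by
    obtain ⟨m, hm, hm'⟩ := Z.isLog t.left v
    have hmu : IsUnit m := isUnit_α_iff.1 (by rw [hm]; exact v.isUnit)
    refine ⟨(ghostSectionsUnit L t hmu.unit).val, hm, fun a ha => ?_⟩
    have h1 : a.1.1 = m := hm' _ ha
    exact ghostSections_ext h1 fun r => hz.snd_eq_one hL (by rwa [h1]) r
  isFs t := .of_forall fun s _ => by
    have := hz.isCancelMul
    obtain ⟨σ, hσ⟩ := exists_section_associates hz.isFsMonoid_ghost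
    exact ⟨L, inferInstance, ghostChart L σ hσ s, hfs, isChart_ghostChart hz L hL σ hσ s⟩

theorem isLogScheme_ofGhostSubmonoid (hz : Z.IsGeometricPoint z) (L : Submonoid (Z.Ghost z × D))
    (hL : ∀ d, (1, d) ∈ L → d = 1) (hfs : IsFsMonoid L) :
    (ofGhostSubmonoid hz L hL hfs).IsLogScheme :=
  (Over.mkIdTerminal (X := z)).hasTerminal

end FsLogCFG

namespace FsLogCFG

variable {X Y Z : FsLogCFG.{u}} {D : Type} [CommMonoid D]

/-! ### Log morphisms and values on geometric points -/

namespace Hom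

/-- The homomorphism of sections given by a log morphism. -/
def flatHom (f : Hom X Y) (x : X.toCat.obj) : Y.M.obj (op (f.obj x)) →* X.M.obj (op x) :=
  (f.flat.app (op x)).hom

theorem flatHom_res (f : Hom X Y) {x' x : X.toCat.obj} (φ : x' ⟶ x)
    (m : Y.M.obj (op (f.obj x))) :
    f.flatHom x' (Y.res (f.map φ) m) = X.res φ (f.flatHom x m) :=
  congrArg (fun h => h.hom m) (f.flat.naturality φ.op)

/-- Invertibility can be tested on functions, where a log morphism is the identity up to the
identification of the base schemes. This makes the maps on ghost stalks local. -/
theorem isUnit_of_isUnit_flatHom (f : Hom X Y) {x : X.toCat.obj} {m : Y.M.obj (op (f.obj x))}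
    (h : IsUnit (f.flatHom x m)) : IsUnit m := by
  have h1 := isUnit_α_iff.2 h
  rw [flatHom, f.α_flat x m] at h1
  refine isUnit_α_iff.1 ?_
  have h2 := h1.map (eqToHom (f.toBasedFunctor.w_obj x)).appTop.hom
  rwa [← CommRingCat.comp_apply, ← Scheme.Hom.comp_appTop, eqToHom_trans, eqToHom_refl,
    Scheme.Hom.id_appTop] at h2

theorem isGeometricPoint_obj (f : Hom X Y) {x : X.toCat.obj} (hx : X.IsGeometricPoint x) :
    Y.IsGeometricPoint (f.obj x) := by
  obtain ⟨K, _, hK, ⟨e⟩⟩ := hx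
  exact ⟨K, _, hK, ⟨eqToIso (f.w_obj x) ≪≫ e⟩⟩

theorem p_map_apply (f : Hom X Y) {x' x : X.toCat.obj} (φ : x' ⟶ x) (s : X.toCat.p.obj x') :
    Y.toCat.p.map (f.map φ) (eqToHom (f.w_obj x').symm s) =
      eqToHom (f.w_obj x).symm (X.toCat.p.map φ s) := by
  rw [BasedFunctor.p_map]
  simp only [← Scheme.Hom.comp_apply, eqToHom_trans_assoc, eqToHom_refl, Category.id_comp]

/-- The homomorphism of ghost stalks at a geometric point. -/
abbrev ghostHom (f : Hom X Y) (x : X.toCat.obj) : Y.Ghost (f.obj x) →* X.Ghost x :=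
  sharpMap (f.flatHom x)

theorem eq_one_of_ghostHom_eq_one (f : Hom X Y) {x : X.toCat.obj} {r : Y.Ghost (f.obj x)}
    (h : f.ghostHom x r = 1) : r = 1 := by
  obtain ⟨m, rfl⟩ := Associates.mk_surjective r
  exact Associates.mk_eq_one.2 (f.isUnit_of_isUnit_flatHom (Associates.mk_eq_one.1 h))

end Hom

namespace Iso₂

theorem flatHom_res {f g : Hom X Y} (η : Iso₂ f g) (x : X.toCat.obj)
    (m : Y.M.obj (op (g.obj x))) : f.flatHom x (Y.res (η.app x) m) = g.flatHom x m :=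
  congrArg (fun h => h.hom m) (η.flat_comp x)

theorem naturality {f g : Hom X Y} (η : Iso₂ f g) {x' x : X.toCat.obj} (φ : x' ⟶ x) :
    f.map φ ≫ η.app x = η.app x' ≫ g.map φ :=
  η.iso.hom.naturality φ

theorem p_map_app_apply {f g : Hom X Y} (η : Iso₂ f g) (x : X.toCat.obj) (s : X.toCat.p.obj x) :
    Y.toCat.p.map (η.app x) (eqToHom (f.w_obj x).symm s) = eqToHom (g.w_obj x).symm s := by
  have h : Y.toCat.p.IsHomLift (𝟙 (X.toCat.p.obj x)) (η.app x) := η.iso.hom.isHomLift' x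
  rw [IsHomLift.fac' Y.toCat.p (𝟙 (X.toCat.p.obj x)) (η.app x)]
  simp only [← Scheme.Hom.comp_apply, eqToHom_trans_assoc, eqToHom_refl, Category.id_comp]

/-- The component of a 2-isomorphism as an isomorphism. -/
def appIso {f g : Hom X Y} (η : Iso₂ f g) (x : X.toCat.obj) : f.obj x ≅ g.obj x where
  hom := η.iso.hom.app x
  inv := η.iso.inv.app x
  hom_inv_id := congrArg (fun h : BasedNatTrans f.toBasedFunctor f.toBasedFunctor => h.app x)
    η.iso.hom_inv_id
  inv_hom_id := congrArg (fun h : BasedNatTrans g.toBasedFunctor g.toBasedFunctor => h.app x)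
    η.iso.inv_hom_id

end Iso₂

namespace IsGeometricPoint

theorem localValue_one {x : X.toCat.obj} (hx : X.IsGeometricPoint x) {y : X.toCat.obj} (φ : y ⟶ x)
    (m : X.M.obj (op y)) (s : X.toCat.p.obj y) :
    hx.localValue (1 : X.Ghost x →* D) φ m s = 1 := by
  obtain ⟨z, ψ, t, ⟨k, v, h⟩, -, rfl⟩ :=
    (hx.exists_eq_res_mul φ m).exists_of_mem X.isFiberedInGroupoids s
  exact hx.localValue_apply 1 φ m ψ k v h t

theorem localValue_flatHom (f : Hom X Y) {x y : X.toCat.obj} (hx : X.IsGeometricPoint x)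
    (u : X.Ghost x →* D) (φ : y ⟶ x) (m : Y.M.obj (op (f.obj y))) (s : X.toCat.p.obj y) :
    hx.localValue u φ (f.flatHom y m) s =
      (f.isGeometricPoint_obj hx).localValue (u.comp (f.ghostHom x)) (f.map φ) m
        (eqToHom (f.w_obj y).symm s) := by
  have h1 := ((f.isGeometricPoint_obj hx).exists_eq_res_mul (f.map φ) m).of_basedFunctor
    f.toBasedFunctor
  obtain ⟨z, ψ, t, ⟨k, v, h⟩, -, rfl⟩ := h1.exists_of_mem X.isFiberedInGroupoids s
  rw [← f.p_map_apply, (f.isGeometricPoint_obj hx).localValue_apply _ (f.map φ) m (f.map ψ) k v h]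
  refine hx.localValue_apply u φ _ ψ (f.flatHom x k) (Units.map (f.flatHom z) v) ?_ t
  rw [← f.flatHom_res, h, map_mul, ← f.map_comp, f.flatHom_res]
  rfl

/-- Changes the reference geometric point. It is used with the components of a 2-isomorphism, which
relate the two images of `z` in `Y`. -/
theorem localValue_comm {x x' y y' : X.toCat.obj} (hx : X.IsGeometricPoint x)
    (hx' : X.IsGeometricPoint x') (e : x' ⟶ x) (ε : y' ⟶ y) (φ : y ⟶ x) (φ' : y' ⟶ x')
    (h : φ' ≫ e = ε ≫ φ) (u : X.Ghost x' →* D) (m : X.M.obj (op y)) (s : X.toCat.p.obj y') :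
    hx'.localValue u φ' (X.res ε m) s =
      hx.localValue (u.comp (sharpMap (X.res e))) φ m (X.toCat.p.map ε s) := by
  obtain ⟨z, ψ, t, ⟨k, v, hk⟩, -, rfl⟩ :=
    (hx.exists_eq_res_mul (ε ≫ φ) (X.res ε m)).exists_of_mem X.isFiberedInGroupoids s
  rw [← Scheme.Hom.comp_apply, ← Functor.map_comp,
    hx.localValue_apply _ φ m (ψ ≫ ε) k v (by rw [res_comp, hk, Category.assoc]),
    hx'.localValue_apply u φ' _ ψ (X.res e k) v (by
      rw [hk, ← res_comp X e, Category.assoc, h])]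
  rfl

end IsGeometricPoint

/-! ### Log morphisms from enlargements of the log structure of a geometric point -/

section Enlargement

variable {z : Z.toCat.obj}

/-- Where `m` is a unit times the pull-back of `k`, the pair is a unit times the pair given by `k`,
which lies over `L` by `hu`. -/
theorem mem_ghostSections_flatHom (hz : Z.IsGeometricPoint z) (L : Submonoid (Z.Ghost z × D))
    (q : Hom Z X) (u : X.Ghost (q.obj z) →* D) (hu : ∀ r, (q.ghostHom z r, u r) ∈ L) (t : Over z)
    (m : X.M.obj (op (q.obj t.left))) :
    (q.flatHom t.left m, (eqToHom (q.w_obj t.left).symm).pullbackLocallyConstant D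
      ((q.isGeometricPoint_obj hz).localValue u (q.map t.hom) m)) ∈ Z.ghostSections L t := by
  have h1 := ((q.isGeometricPoint_obj hz).exists_eq_res_mul (q.map t.hom) m).of_basedFunctor
    q.toBasedFunctor
  refine h1.mono fun y ψ => ?_
  rintro ⟨k, v, h⟩
  refine ⟨q.flatHom z k, u (Associates.mk k), Units.map (q.flatHom y) v, hu (Associates.mk k), ?_,
    fun s => ?_⟩
  · rw [← q.flatHom_res, h, map_mul, ← q.map_comp, q.flatHom_res]
    rfl
  · rw [Scheme.Hom.pullbackLocallyConstant_apply, ← q.p_map_apply]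
    exact (q.isGeometricPoint_obj hz).localValue_apply u _ m _ k v h _

/-- The forgetful functor from the objects over `z`. -/
def overForget (𝒳 : BasedCategory.{u, u + 1} Scheme.{u}) (z : 𝒳.obj) :
    BasedFunctor (overCat 𝒳 z) 𝒳 where
  toFunctor := Over.forget z
  w := rfl

/-- The log morphism from an enlargement of the log structure of `z` to `X` given by a log morphism
`q : Z → X` and a homomorphism on the ghost stalk of `X` at `q z`. -/
def homOfGhost (hz : Z.IsGeometricPoint z) (L : Submonoid (Z.Ghost z × D))
    (hL : ∀ d, (1, d) ∈ L → d = 1) (hfs : IsFsMonoid L) (q : Hom Z X)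
    (u : X.Ghost (q.obj z) →* D) (hu : ∀ r, (q.ghostHom z r, u r) ∈ L) :
    Hom (ofGhostSubmonoid hz L hL hfs) X where
  toBasedFunctor := (overForget Z.toCat z).comp q.toBasedFunctor
  flat :=
    { app := fun t => CommMonCat.ofHom
        ((((q.flatHom t.unop.left).prod
          (((eqToHom (q.w_obj t.unop.left).symm).pullbackLocallyConstant D).comp
            ((q.isGeometricPoint_obj hz).localValue u (q.map t.unop.hom))))).codRestrict
          (Z.ghostSections L t.unop) fun m => mem_ghostSections_flatHom hz L q u hu t.unop m)
      naturality := fun t s φ => CommMonCat.hom_ext (MonoidHom.ext fun m =>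
        ghostSections_ext (q.flatHom_res φ.unop.left m) fun r => by
          have key : ∀ {s t : Over z} (φ : s ⟶ t) (m : X.M.obj (op (q.obj t.left)))
              (r : Z.toCat.p.obj s.left),
              (q.isGeometricPoint_obj hz).localValue u (q.map s.hom) (X.res (q.map φ.left) m)
                (eqToHom (q.w_obj s.left).symm r) =
              (q.isGeometricPoint_obj hz).localValue u (q.map t.hom) m
                (eqToHom (q.w_obj t.left).symm (Z.toCat.p.map φ.left r)) := by
            intro s t φ m r
            rw [← Over.w φ, q.map_comp, IsGeometricPoint.localValue_res, q.p_map_apply]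
          exact key φ.unop m r) }
  α_flat t m := q.α_flat t.left m

/-- The log morphism between enlargements of the log structure of `z` given by the identity on the
log structure of `Z`. -/
def homOfForall (hz : Z.IsGeometricPoint z) {D' : Type} [CommMonoid D']
    (L : Submonoid (Z.Ghost z × D))
    (hL : ∀ d, (1, d) ∈ L → d = 1) (hfs : IsFsMonoid L) (L' : Submonoid (Z.Ghost z × D'))
    (hL' : ∀ d, (1, d) ∈ L' → d = 1) (hfs' : IsFsMonoid L') (h : ∀ r, (r, 1) ∈ L') :
    Hom (ofGhostSubmonoid hz L' hL' hfs') (ofGhostSubmonoid hz L hL hfs) where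
  toBasedFunctor := BasedFunctor.id _
  flat :=
    { app := fun t => CommMonCat.ofHom
        ((((MonoidHom.fst _ _).prod 1).comp (Z.ghostSections L t.unop).subtype).codRestrict
          (Z.ghostSections L' t.unop) fun m => EtaleLocally.mono m.2 fun y ψ => by
            rintro ⟨k, d, v, -, hv, -⟩
            exact ⟨k, 1, v, h _, hv, fun _ => rfl⟩)
      naturality := fun t s φ => rfl }
  α_flat t m := by
    change Z.α t.left m.1.1 = (𝟙 (Z.toCat.p.obj t.left) : _).appTop (Z.α t.left m.1.1)
    rw [Scheme.Hom.id_appTop]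
    rfl

end Enlargement

end FsLogCFG

/-! ### 2-isomorphisms on enlargements -/

namespace FsLogCFG

variable {W X Y Z : FsLogCFG.{u}} {D : Type} [CommMonoid D] {g : Hom W Y} {f : Hom X Y}
  {p : Hom Z W} {q : Hom Z X} {z : Z.toCat.obj}

/-- The 2-isomorphism between log morphisms from an enlargement of the log structure of `z` that
is induced by a 2-isomorphism `γ`. -/
def Iso₂.ofGhost (γ : Iso₂ (p.comp g) (q.comp f)) (hz : Z.IsGeometricPoint z)
    (L : Submonoid (Z.Ghost z × D)) (hL : ∀ d, (1, d) ∈ L → d = 1) (hfs : IsFsMonoid L)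
    (uW : W.Ghost (p.obj z) →* D) (huW : ∀ r, (p.ghostHom z r, uW r) ∈ L)
    (uX : X.Ghost (q.obj z) →* D) (huX : ∀ r, (q.ghostHom z r, uX r) ∈ L)
    (hu : (uW.comp (g.ghostHom (p.obj z))).comp (sharpMap (Y.res (γ.app z))) =
      uX.comp (f.ghostHom (q.obj z))) :
    Iso₂ ((homOfGhost hz L hL hfs p uW huW).comp g) ((homOfGhost hz L hL hfs q uX huX).comp f) where
  iso :=
    { hom := BasedCategory.whiskerLeft (overForget Z.toCat z) γ.iso.hom
      inv := BasedCategory.whiskerLeft (overForget Z.toCat z) γ.iso.inv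
      hom_inv_id := congrArg (BasedCategory.whiskerLeft (overForget Z.toCat z)) γ.iso.hom_inv_id
      inv_hom_id := congrArg (BasedCategory.whiskerLeft (overForget Z.toCat z)) γ.iso.inv_hom_id }
  flat_comp t := CommMonCat.hom_ext (MonoidHom.ext fun m => by
    refine ghostSections_ext (γ.flatHom_res (Over.left t) m) fun r => ?_
    have key : ∀ (t : Over z) (m : Y.M.obj (op (f.obj (q.obj t.left)))) (r : Z.toCat.p.obj t.left),
        (p.isGeometricPoint_obj hz).localValue uW (p.map t.hom)
          (g.flatHom (p.obj t.left) (Y.res (γ.app t.left) m)) (eqToHom (p.w_obj t.left).symm r) =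
        (q.isGeometricPoint_obj hz).localValue uX (q.map t.hom) (f.flatHom (q.obj t.left) m)
          (eqToHom (q.w_obj t.left).symm r) := by
      intro t m r
      have h1 : ∀ {S₁ S₂ S₃ : Scheme.{u}} (h : S₁ = S₂) (h' : S₂ = S₃) (s : S₁),
          eqToHom h' (eqToHom h s) = eqToHom (h.trans h') s := by
        rintro S _ _ rfl rfl s
        rfl
      refine (IsGeometricPoint.localValue_flatHom g (p.isGeometricPoint_obj hz) uW (p.map t.hom)
        (Y.res (γ.app t.left) m) _).trans (Eq.trans ?_
        (IsGeometricPoint.localValue_flatHom f (q.isGeometricPoint_obj hz) uX (q.map t.hom) m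
          _).symm)
      refine (IsGeometricPoint.localValue_comm
        (f.isGeometricPoint_obj (q.isGeometricPoint_obj hz))
        (g.isGeometricPoint_obj (p.isGeometricPoint_obj hz)) (γ.app z) (γ.app t.left)
        (f.map (q.map t.hom)) (g.map (p.map t.hom)) (γ.naturality t.hom) _ m _).trans ?_
      have h2 := γ.p_map_app_apply t.left r
      rw [h1, h1]
      exact (DFunLike.congr_fun (congrArg (fun u => IsGeometricPoint.localValue
        (f.isGeometricPoint_obj (q.isGeometricPoint_obj hz)) u (f.map (q.map t.hom)) m) hu) _).trans
        (congrArg _ h2)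
    exact key t m r)

end FsLogCFG

/-! ### The universal property applied to the enlargement -/

namespace FsLogCFG

/-- The identity log morphism. -/
def Hom.id (X : FsLogCFG.{u}) : Hom X X where
  toBasedFunctor := BasedFunctor.id _
  flat := { app := fun x => 𝟙 (X.M.obj x)
            naturality := fun x y φ => by
              exact (Category.comp_id (X.M.map φ)).trans (Category.id_comp (X.M.map φ)).symm }
  α_flat x m := by
    change X.α x m = (𝟙 (X.toCat.p.obj x) : _).appTop (X.α x m)
    rw [Scheme.Hom.id_appTop]
    rfl

variable {W X Y Z : FsLogCFG.{u}} {D : Type} [CommMonoid D] {g : Hom W Y} {f : Hom X Y}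
  {p : Hom Z W} {q : Hom Z X} {z : Z.toCat.obj}

theorem ghostSections_mk_snd_mem (hz : Z.IsGeometricPoint z) {L : Submonoid (Z.Ghost z × D)}
    (a : Z.ghostSections L (Over.mk (𝟙 z))) (s : Z.toCat.p.obj z) :
    (Associates.mk (a.1.1 : Z.M.obj (op z)), a.1.2 s) ∈ L := by
  obtain ⟨k, d, (v : (Z.M.obj (op z))ˣ), hk, hv, hd⟩ := hz.etaleLocally (x := z) a.2
  have h1 : (a.1.1 : Z.M.obj (op z)) = k * v.val := by
    have h2 : Z.res (𝟙 z) a.1.1 = Z.res (𝟙 z ≫ 𝟙 z) k * v.val := hv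
    rwa [Category.comp_id, res_id, res_id] at h2
  have h3 : a.1.2 s = d := by
    have h4 := hd s
    rw [CategoryTheory.Functor.map_id] at h4
    exact h4
  have h4 : Associates.mk (k * v.val) = Associates.mk k :=
    Associates.mk_eq_mk_iff_associated.2 (associated_mul_unit_left k v.val v.isUnit)
  have h5 : ((Associates.mk k, d) : Z.Ghost z × D) = (Associates.mk a.1.1, a.1.2 s) :=
    Prod.ext (h4.symm.trans (congrArg Associates.mk h1.symm)) h3.symm
  exact h5 ▸ hk

/-- A homomorphism from the log structure at a geometric point `z` to its enlargement that is a
section of the projection induces a homomorphism on the ghost stalk. -/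
theorem exists_ghostHom_of_section (hz : Z.IsGeometricPoint z) {L : Submonoid (Z.Ghost z × D)}
    (hL : ∀ d, (1, d) ∈ L → d = 1)
    (σ : Z.M.obj (op z) →* Z.ghostSections L (Over.mk (𝟙 z))) (hσ : ∀ m, (σ m).1.1 = m)
    (s : Z.toCat.p.obj z) :
    ∃ u : Z.Ghost z →* D, (∀ r, (r, u r) ∈ L) ∧ ∀ m, u (Associates.mk m) = (σ m).1.2 s := by
  let v : Z.M.obj (op z) →* D :=
    { toFun := fun m => (σ m).1.2 s
      map_one' := by rw [map_one]; rfl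
      map_mul' := fun m n => by rw [map_mul]; rfl }
  have hv : ∀ m n, Associated m n → v m = v n := by
    rintro m _ ⟨t, rfl⟩
    have h1 : v t = 1 := hz.snd_eq_one hL (a := σ t) (by rw [hσ]; exact t.isUnit) s
    rw [map_mul, h1, mul_one]
  refine ⟨{ toFun := Quotient.lift v hv, map_one' := v.map_one, map_mul' := fun a b => ?_ },
    fun r => ?_, fun m => rfl⟩
  · induction a using Quotient.inductionOn
    induction b using Quotient.inductionOn
    exact v.map_mul _ _
  · obtain ⟨m, rfl⟩ := Associates.mk_surjective r
    have h1 := ghostSections_mk_snd_mem hz (σ m) s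
    rw [hσ] at h1
    exact h1

/-- Compatible homomorphisms on ghost stalks of `W` and `X` extend to the ghost stalk of the fs
fibre product. -/
theorem IsFsFibreProduct.exists_ghostHom {γ : Iso₂ (p.comp g) (q.comp f)}
    (hγ : IsFsFibreProduct γ) (hz : Z.IsGeometricPoint z)
    (L : Submonoid (Z.Ghost z × D)) (hL : ∀ d, (1, d) ∈ L → d = 1) (hfs : IsFsMonoid L)
    (uW : W.Ghost (p.obj z) →* D) (huW : ∀ r, (p.ghostHom z r, uW r) ∈ L)
    (uX : X.Ghost (q.obj z) →* D) (huX : ∀ r, (q.ghostHom z r, uX r) ∈ L)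
    (hu : (uW.comp (g.ghostHom (p.obj z))).comp (sharpMap (Y.res (γ.app z))) =
      uX.comp (f.ghostHom (q.obj z))) :
    ∃ u : Z.Ghost z →* D, (∀ r, (r, u r) ∈ L) ∧ u.comp (p.ghostHom z) = uW ∧
      u.comp (q.ghostHom z) = uX := by
  obtain ⟨h, μ, ν, hμν⟩ := hγ.lift _ (isLogScheme_ofGhostSubmonoid hz L hL hfs)
    _ _ (γ.ofGhost hz L hL hfs uW huW uX huX hu)
  -- The graph of zero: its enlargement carries only trivial functions, so it is `z` with its own
  -- log structure, and fs-ness comes from the general lemma.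
  let L₀ := satGraph (MonoidHom.id (Z.Ghost z)) 0
  have hL₀ : ∀ r, (r, 1) ∈ L₀ := fun r => mem_satGraph r
  have hL₀' : ∀ r d, (r, d) ∈ L₀ → d = 1 := by
    rintro r d ⟨-, n, hn, a, -, h⟩
    have h1 : (n : ℝ) * Multiplicative.toAdd d = 0 := h
    have h2 : (n : ℝ) ≠ 0 := by positivity
    exact Multiplicative.toAdd.injective ((mul_eq_zero.1 h1).resolve_left h2)
  have hfs₀ : IsFsMonoid L₀ := by
    have := hz.isFsMonoid_ghost.fg
    exact isFsMonoid_satGraph hz.isFsMonoid_ghost _ _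
  let T₀ := ofGhostSubmonoid hz L₀ (hL₀' 1) hfs₀
  let i : Hom T₀ Z := homOfGhost hz L₀ (hL₀' 1) hfs₀ (Hom.id Z) 1 fun r => by
    obtain ⟨m, rfl⟩ := Associates.mk_surjective r
    exact hL₀ _
  let j : Hom T₀ (ofGhostSubmonoid hz L hL hfs) :=
    homOfForall hz L hL hfs L₀ (hL₀' 1) hfs₀ hL₀
  have key : ∀ {V : FsLogCFG.{u}} (q : Hom Z V) (u : V.Ghost (q.obj z) →* D)
      (hu : ∀ r, (q.ghostHom z r, u r) ∈ L)
      (μ : Iso₂ (h.comp q) (homOfGhost hz L hL hfs q u hu)) (t : Over z)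
      (m : V.M.obj (op (q.obj (h.obj t)))),
      i.flatHom t (q.flatHom t.left (V.res (μ.appIso t).inv m)) =
        j.flatHom t (h.flatHom t (q.flatHom (h.obj t) m)) := by
    intro V q u hu μ t m
    have h1 : h.flatHom t (q.flatHom (h.obj t) m) = (homOfGhost hz L hL hfs q u hu).flatHom t
        (V.res (μ.appIso t).inv m) :=
      (congrArg (fun n => h.flatHom t (q.flatHom (h.obj t) n))
        (V.res_res_inv (μ.appIso t) m).symm).trans (μ.flatHom_res t _)
    exact ghostSections_ext (congrArg (fun a => a.1.1) h1).symm fun r =>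
      ((Hom.id Z).isGeometricPoint_obj hz).localValue_one _ _ _
  -- `j` is the identity on underlying categories, so the inverse of `μ` serves again; the twist by
  -- `uW` disappears because `j` discards the functions.
  let μ' : Iso₂ (i.comp p) ((j.comp h).comp p) :=
    { iso := μ.iso.symm
      flat_comp := fun t => CommMonCat.hom_ext (MonoidHom.ext fun m => key p uW huW μ t m) }
  let ν' : Iso₂ (i.comp q) ((j.comp h).comp q) :=
    { iso := ν.iso.symm
      flat_comp := fun t => CommMonCat.hom_ext (MonoidHom.ext fun m => key q uX huX ν t m) }
  obtain ⟨η, hη, -⟩ := hγ.unique T₀ (isLogScheme_ofGhostSubmonoid hz L₀ (hL₀' 1) hfs₀) i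
    (j.comp h) μ' ν' fun t =>
      ((g.mapIso (μ.appIso t)).inv_comp_eq).2
        (((f.mapIso (ν.appIso t)).eq_comp_inv.2 (hμν t).symm).trans (Category.assoc _ _ _))
  let t₀ : Over z := Over.mk (𝟙 z)
  obtain ⟨s⟩ := hz.nonempty
  -- At the terminal object, `h` corrected by `η` maps the sections of `Z` at `z` to pairs. As `η`
  -- compares `j ≫ h` with the tautological `i`, the first components are unchanged; the second ones
  -- define `u`.
  obtain ⟨u, hu1, hu2⟩ := exists_ghostHom_of_section hz hL
    ((h.flatHom t₀).comp (Z.res (η.appIso t₀).inv)) (fun m => by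
      have h1 := (η.flatHom_res t₀ (Z.res (η.appIso t₀).inv m)).symm.trans
        (congrArg (i.flatHom t₀) (Z.res_res_inv (η.appIso t₀) m))
      exact congrArg (fun a => a.1.1) h1) s
  have key' : ∀ {V : FsLogCFG.{u}} (q : Hom Z V) (v : V.Ghost (q.obj z) →* D)
      (hv : ∀ r, (q.ghostHom z r, v r) ∈ L)
      (μ : Iso₂ (h.comp q) (homOfGhost hz L hL hfs q v hv)),
      q.map (η.app t₀) = (μ.appIso t₀).inv → u.comp (q.ghostHom z) = v := by
    intro V q v hv μ hμ
    refine MonoidHom.ext fun r => ?_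
    obtain ⟨m, rfl⟩ := Associates.mk_surjective r
    have h1 : q.map (η.appIso t₀).inv = μ.app t₀ :=
      congrArg Iso.inv (Iso.ext hμ : q.mapIso (η.appIso t₀) = (μ.appIso t₀).symm)
    have h2 : h.flatHom t₀ (Z.res (η.appIso t₀).inv (q.flatHom z m)) =
        (homOfGhost hz L hL hfs q v hv).flatHom t₀ m := by
      refine (congrArg (h.flatHom t₀) (q.flatHom_res (η.appIso t₀).inv m).symm).trans ?_
      rw [h1]
      exact μ.flatHom_res t₀ m
    have h3 : (q.isGeometricPoint_obj hz).localValue v (q.map (𝟙 z)) m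
        (eqToHom (q.w_obj z).symm s) = v (Associates.mk m) := by
      rw [q.map_id, IsGeometricPoint.localValue_id]
    exact (hu2 _).trans ((congrArg (fun a => a.1.2 s) h2).trans h3)
  exact ⟨u, hu1, key' p uW huW μ (hη t₀).1, key' q uX huX ν (hη t₀).2⟩

end FsLogCFG

/-! ### Ghost stalks of the fs fibre product -/

namespace FsLogCFG

theorem Hom.ghost_refl {X Y : FsLogCFG.{u}} (f : Hom X Y) (x : X.toCat.obj) :
    f.ghost x (Iso.refl _) = f.ghostHom x := by
  refine MonoidHom.ext fun r => ?_
  obtain ⟨m, rfl⟩ := Associates.mk_surjective r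
  exact congrArg (fun n => Associates.mk (f.flatHom x n)) (Y.res_id _ m)

variable {W X Y Z : FsLogCFG.{u}} {g : Hom W Y} {f : Hom X Y} {p : Hom Z W} {q : Hom Z X}

theorem Iso₂.ghost_comp (γ : Iso₂ (p.comp g) (q.comp f)) (z : Z.toCat.obj) :
    (q.ghostHom z).comp (f.ghost (q.obj z) (Iso.refl _)) =
      (p.ghostHom z).comp (g.ghost (p.obj z) (γ.appIso z)) := by
  rw [Hom.ghost_refl]
  refine MonoidHom.ext fun r => ?_
  obtain ⟨m, rfl⟩ := Associates.mk_surjective r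
  exact congrArg Associates.mk (γ.flatHom_res z m).symm

/-- Every pair of homomorphisms on ghost stalks of `W` and `X` with the same restriction to the
ghost stalk of `Y` is induced by a homomorphism on the ghost stalk of the fs fibre product; the
latter is the saturation of the images of the ghost stalks of `W` and `X`. -/
theorem IsFsFibreProduct.exists_addMonoidHom {γ : Iso₂ (p.comp g) (q.comp f)}
    (hγ : IsFsFibreProduct γ) {z : Z.toCat.obj} (hz : Z.IsGeometricPoint z)
    (v : Additive (X.Ghost (q.obj z)) →+ ℝ) (w : Additive (W.Ghost (p.obj z)) →+ ℝ)
    (hvw : dualMap (f.ghost (q.obj z) (Iso.refl _)) v =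
      dualMap (g.ghost (p.obj z) (γ.appIso z)) w) :
    ∃ u : Additive (Z.Ghost z) →+ ℝ, dualMap (q.ghostHom z) u = v ∧
      dualMap (p.ghostHom z) u = w ∧ ∀ r : Z.Ghost z, ∃ n : ℕ, 0 < n ∧ ∃ a b,
        r ^ n = q.ghostHom z a * p.ghostHom z b ∧
        n * u (.ofMul r) = v (.ofMul a) + w (.ofMul b) := by
  have hX := (q.isGeometricPoint_obj hz).isFsMonoid_ghost
  have hW := (p.isGeometricPoint_obj hz).isFsMonoid_ghost
  have := hX.fg
  have := hW.fg
  let ρ : X.Ghost (q.obj z) × W.Ghost (p.obj z) →* Z.Ghost z :=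
    (q.ghostHom z).coprod (p.ghostHom z)
  let t : Additive (X.Ghost (q.obj z) × W.Ghost (p.obj z)) →+ ℝ :=
    MonoidHom.toAdditiveLeft ((AddMonoidHom.toMultiplicativeRight v).coprod
      (AddMonoidHom.toMultiplicativeRight w))
  have ht : ∀ a b, t (.ofMul (a, b)) = v (.ofMul a) + w (.ofMul b) := fun a b => rfl
  let L := satGraph ρ t
  -- The ghost stalk is sharp and the maps from those of `X` and `W` are local, so a product of
  -- images equal to `1` comes only from `a = 1`, `b = 1`.
  have hL : ∀ d, (1, d) ∈ L → d = 1 := by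
    rintro d ⟨-, n, hn, ⟨a, b⟩, h1, h2⟩
    have h3 : q.ghostHom z a * p.ghostHom z b = 1 := h1.symm.trans (one_pow n)
    have h4 := mul_eq_one.1 h3
    rw [q.eq_one_of_ghostHom_eq_one h4.1, p.eq_one_of_ghostHom_eq_one h4.2, ht, ofMul_one, ofMul_one,
      map_zero, map_zero, add_zero] at h2
    have h5 : (n : ℝ) ≠ 0 := by positivity
    exact Multiplicative.toAdd.injective ((mul_eq_zero.1 h2).resolve_left h5)
  obtain ⟨u, hu, hp, hq⟩ := hγ.exists_ghostHom hz L hL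
    (isFsMonoid_satGraph hz.isFsMonoid_ghost ρ t)
    (AddMonoidHom.toMultiplicativeRight w)
    (fun b => by
      have h := mem_satGraph (ρ := ρ) (u := t) (1, b)
      have h1 : ρ (1, b) = p.ghostHom z b := by simp [ρ]
      have h2 : t (.ofMul (1, b)) = w (.ofMul b) := by
        rw [ht, ofMul_one, map_zero, zero_add]
      rw [h1, h2] at h
      exact h)
    (AddMonoidHom.toMultiplicativeRight v)
    (fun a => by
      have h := mem_satGraph (ρ := ρ) (u := t) (a, 1)
      have h1 : ρ (a, 1) = q.ghostHom z a := by simp [ρ]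
      have h2 : t (.ofMul (a, 1)) = v (.ofMul a) := by
        rw [ht, ofMul_one, map_zero, add_zero]
      rw [h1, h2] at h
      exact h)
    (by
      rw [Hom.ghost_refl] at hvw
      refine MonoidHom.ext fun r => ?_
      obtain ⟨m, rfl⟩ := Associates.mk_surjective r
      exact congrArg Multiplicative.ofAdd (DFunLike.congr_fun hvw (.ofMul (Associates.mk m))).symm)
  refine ⟨MonoidHom.toAdditiveLeft u, ?_, ?_, fun r => ?_⟩
  · exact AddMonoidHom.ext fun r => DFunLike.congr_fun hq r.toMul
  · exact AddMonoidHom.ext fun r => DFunLike.congr_fun hp r.toMul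
  · obtain ⟨-, n, hn, ⟨a, b⟩, h1, h2⟩ := hu r
    exact ⟨n, hn, a, b, h1, h2⟩

end FsLogCFG

end

theorem mainTheorem12 (X Y W : FsLogStack.{u})
    (f : FsLogCFG.Hom X.toFsLogCFG Y.toFsLogCFG) (g : FsLogCFG.Hom W.toFsLogCFG Y.toFsLogCFG)
    (hW : W.IsFree)
    (hface : ∀ (x : X.toCat.obj) (y : Y.toCat.obj) (w : W.toCat.obj),
      X.IsGeometricPoint x → Y.IsGeometricPoint y → W.IsGeometricPoint w →
      ∀ (e : f.obj x ≅ y) (e' : g.obj w ≅ y)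
        (F : PointedCone ℝ (Additive (X.Ghost x) →+ ℝ)), F.IsFaceOf (X.cone x) →
        (PointedCone.comap (g.trop w e') (PointedCone.map (f.trop x e) F) ⊓ W.cone w).IsFaceOf
          (W.cone w)) :
    IsTransverse g f := by
  intro Z p q γ hγ z hz
  have hx := q.isGeometricPoint_obj hz
  have hw := p.isGeometricPoint_obj hz
  rw [FsLogCFG.Hom.ghost_refl]
  -- The point of `Y` is taken to be `f (q z)`, identified with `g (p z)` through `γ`.
  refine isIntegralMonoidHom_of_isFaceOf hz.isFsMonoid_ghost (hW _ hw)
    (f.ghost (q.obj z) (Iso.refl _)) (g.ghost (p.obj z) (γ.appIso z)) (q.ghostHom z)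
    (p.ghostHom z) (γ.ghost_comp z) (fun r => ?_) (fun v hv w hw hvw => ?_)
    (fun F hF => hface _ _ _ hx (f.isGeometricPoint_obj hx) hw (Iso.refl _) (γ.appIso z) F hF)
  -- The zero homomorphisms already show that every element has a power in the product of the
  -- images.
  · obtain ⟨u, -, -, h⟩ := hγ.exists_addMonoidHom hz 0 0 rfl
    obtain ⟨n, hn, a, b, hab, -⟩ := h r
    exact ⟨n, hn, a, b, hab⟩
  · obtain ⟨u, hv', hw', h⟩ := hγ.exists_addMonoidHom hz v w hvw
    refine ⟨u, fun r => ?_, hv', hw'⟩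
    obtain ⟨n, hn, a, b, -, hab⟩ := h r.toMul
    have h1 : 0 ≤ (n : ℝ) * u r := by
      rw [show u r = u (.ofMul r.toMul) from rfl, hab]
      exact add_nonneg (hv _) (hw _)
    exact nonneg_of_mul_nonneg_right h1 (by positivity)
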